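/- For a pattern $\sigma$ (a permutation in one-line notation), let $A^\sigma_n$ and $A^\sigma_{n,i}$ be the number of $\sigma$-avoiding permutations of $[n]=\{1,\dots,n\}$, respectively of those with exactly $i$ descents (classical pattern avoidance). A permutation $\pi_1\cdots\pi_n$ of $[n]$, $n\ge 1$, is indecomposable if there is no $j$ with $1\le j<n$ such that $\pi_1\cdots\pi_j$ is a permutation of $[j]$. Let $I^\sigma_n$ and $I^\sigma_{n,i}$ be the number of $\sigma$-avoiding indecomposable permutations of $[n]$, respectively of those with exactly $i$ descents. Put, as formal power series, $$A^\sigma(x,q)=\sum_{n\ge 0}\sum_{i\ge 0}A^\sigma_{n,i}x^nq^i,\quad I^\sigma(x,q)=\sum_{n\ge 1}\sum_{i\ge 0}I^\sigma_{n,i}x^nq^i,\quad A^\sigma(x)=\sum_{n\ge 0}A^\sigma_nx^n,\quad I^\sigma(x)=\sum_{n\ge 1}I^\sigma_nx^n,$$ where the empty permutation contributes $1$ to $A^\sigma(x,q)$. Let $C_i=\frac1{i+1}\binom{2i}{i}$ be the Catalan numbers, and let $$F(x)=\frac{32x}{1+20x-8x^2-(1-8x)^{3/2}},$$ $$F_n=\frac{7n^2-3n-2}{2}(-1)^{n-1}+3\sum_{i=2}^{n}(-1)^{n-i}2^{i+1}\frac{(2i-4)!}{i!\,(i-2)!}\binom{n-i+2}{2}\qquad(n\ge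 1).$$ **Theorem.** The following identities hold: $$A^{2314}(x,q)=1+I^{2314}(x,q)+I^{231}(x,q)\bigl(A^{2314}(x,q)-1\bigr),$$ $$A^{3124}(x,q)=1+I^{3124}(x,q)+I^{312}(x,q)\bigl(A^{3124}(x,q)-1\bigr).$$ For $\tau\in\{1342,2314,3124\}$ one has $A^\tau(x)=F(x)$, and $A^\tau_n=F_n$ for all $n\ge 1$. Further, for $\sigma\in\{2314,3124\}$, $$I^\sigma(x)=\tfrac12\bigl(\sqrt{1-4x}+1\bigr)\bigl(F(x)-1\bigr)=\tfrac12\bigl(\sqrt{1-4x}+1\bigr)\left(\frac{32x}{1+20x-8x^2-(1-8x)^{3/2}}-1\right),$$ $I^\sigma_1=1$, and for all $n\ge 2$, $$I^\sigma_n=F_n-\sum_{i=0}^{n-2}C_iF_{n-1-i}.$$ -/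

import Mathlib

open scoped PowerSeries LaurentSeries Polynomial

namespace IndecPerm

/-- `π` contains the classical pattern `σ = σ₁ ⋯ σₖ`: some subsequence of `π`, at positions
`f 0 < ⋯ < f (k - 1)`, is order-isomorphic to `σ`. Permutations of `[n]` are permutations of
`Fin n`; a pattern is written in one-line notation, for example `![2, 3, 1, 4]`. -/
def Contains {k n : ℕ} (σ : Fin k → ℕ) (π : Equiv.Perm (Fin n)) : Prop :=
  ∃ f : Fin k → Fin n, StrictMono f ∧ ∀ a b : Fin k, π (f a) < π (f b) ↔ σ a < σ b

/-- `π` avoids the classical pattern `σ`. -/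
def Avoids {k n : ℕ} (σ : Fin k → ℕ) (π : Equiv.Perm (Fin n)) : Prop :=
  ¬ Contains σ π

/-- `π` is indecomposable: it is nonempty, and no nonempty proper initial segment
`π₁ ⋯ πⱼ` (`1 ≤ j < n`) is a permutation of `[j]`. -/
def Indecomposable {n : ℕ} (π : Equiv.Perm (Fin n)) : Prop :=
  0 < n ∧ ∀ j : ℕ, 0 < j → j < n →
    π '' {i : Fin n | (i : ℕ) < j} ≠ {i : Fin n | (i : ℕ) < j}

/-- The number of descents of `π`, that is, of adjacent positions with `πᵢ > πᵢ₊₁`. -/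
noncomputable def des {n : ℕ} (π : Equiv.Perm (Fin n)) : ℕ :=
  Set.ncard {i : Fin n | ∃ h : (i : ℕ) + 1 < n, π ⟨(i : ℕ) + 1, h⟩ < π i}

/-- `A_n^σ`: the number of `σ`-avoiding permutations of `[n]`. -/
noncomputable def avoidCount {k : ℕ} (σ : Fin k → ℕ) (n : ℕ) : ℕ :=
  Set.ncard {π : Equiv.Perm (Fin n) | Avoids σ π}

/-- `I_n^σ`: the number of `σ`-avoiding indecomposable permutations of `[n]`. -/
noncomputable def indecCount {k : ℕ} (σ : Fin k → ℕ) (n : ℕ) : ℕ :=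
  Set.ncard {π : Equiv.Perm (Fin n) | Avoids σ π ∧ Indecomposable π}

/-- `A_{n,i}^σ`: the number of `σ`-avoiding permutations of `[n]` with `i` descents. -/
noncomputable def avoidDesCount {k : ℕ} (σ : Fin k → ℕ) (n i : ℕ) : ℕ :=
  Set.ncard {π : Equiv.Perm (Fin n) | Avoids σ π ∧ des π = i}

/-- `I_{n,i}^σ`: the number of `σ`-avoiding indecomposable permutations of `[n]` with
`i` descents. -/
noncomputable def indecDesCount {k : ℕ} (σ : Fin k → ℕ) (n i : ℕ) : ℕ :=
  Set.ncard {π : Equiv.Perm (Fin n) | Avoids σ π ∧ Indecomposable π ∧ des π = i}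

/-- `A^σ(x, q) = ∑ A_{n,i}^σ xⁿ qⁱ`, a power series in `x` over `ℤ[q]`. The range `0 ≤ i ≤ n`
is used so that the empty permutation (`n = i = 0`) is counted; for `n ≥ 1` the
term `i = n` vanishes. -/
noncomputable def avoidGF₂ {k : ℕ} (σ : Fin k → ℕ) : ℤ[X]⟦X⟧ :=
  PowerSeries.mk fun n =>
    ∑ i ∈ Finset.range (n + 1), Polynomial.monomial i (avoidDesCount σ n i : ℤ)

/-- `I^σ(x, q) = ∑ I_{n,i}^σ xⁿ qⁱ`; the term `n = 0` vanishes. -/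
noncomputable def indecGF₂ {k : ℕ} (σ : Fin k → ℕ) : ℤ[X]⟦X⟧ :=
  PowerSeries.mk fun n =>
    ∑ i ∈ Finset.range (n + 1), Polynomial.monomial i (indecDesCount σ n i : ℤ)

/-- `A^σ(x) = ∑ A_n^σ xⁿ`. -/
noncomputable def avoidGF {k : ℕ} (σ : Fin k → ℕ) : ℚ⟦X⟧ :=
  PowerSeries.mk fun n => (avoidCount σ n : ℚ)

/-- `I^σ(x) = ∑ I_n^σ xⁿ`; the term `n = 0` vanishes. -/
noncomputable def indecGF {k : ℕ} (σ : Fin k → ℕ) : ℚ⟦X⟧ :=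
  PowerSeries.mk fun n => (indecCount σ n : ℚ)

/-- The formal power series `(1 + c x)^r = ∑ (r choose n) cⁿ xⁿ`. -/
noncomputable def binomPow (c r : ℚ) : ℚ⟦X⟧ :=
  PowerSeries.rescale c (PowerSeries.binomialSeries ℚ r)

/-- `√(1 - 4x)`. -/
noncomputable def sqrtOneSubFourX : ℚ⟦X⟧ := binomPow (-4) (1 / 2)

/-- `1 + 20 x - 8 x² - (1 - 8x)^{3/2}`. -/
noncomputable def bonaDenom : ℚ⟦X⟧ :=
  1 + 20 * PowerSeries.X - 8 * PowerSeries.X ^ 2 - binomPow (-8) (3 / 2)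

/-- `F(x) = 32 x / (1 + 20 x - 8 x² - (1 - 8x)^{3/2})`. The denominator has constant term `0`,
so the quotient is formed in the field of formal Laurent series. -/
noncomputable def bonaF : ℚ⸨X⸩ :=
  ((32 * PowerSeries.X : ℚ⟦X⟧) : ℚ⸨X⸩) / (bonaDenom : ℚ⸨X⸩)

/-- The closed formula for `F_n`, `n ≥ 1`:
`(7n² - 3n - 2)/2 (-1)^{n-1}
  + 3 ∑_{i=2}^n (-1)^{n-i} 2^{i+1} (2i-4)! / (i! (i-2)!) (n-i+2 choose 2)`. -/
noncomputable def bonaNumber (n : ℕ) : ℚ :=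
  (7 * (n : ℚ) ^ 2 - 3 * n - 2) / 2 * (-1) ^ (n - 1)
    + 3 * ∑ i ∈ Finset.Icc 2 n,
        (-1 : ℚ) ^ (n - i) * 2 ^ (i + 1)
          * ((Nat.factorial (2 * i - 4) : ℚ)
              / ((Nat.factorial i : ℚ) * (Nat.factorial (i - 2) : ℚ)))
          * (Nat.choose (n - i + 2) 2 : ℚ)

theorem sqrtOneSubFourX_sq : sqrtOneSubFourX ^ 2 = 1 - 4 * PowerSeries.X := by
  have h : (PowerSeries.binomialSeries ℚ (1 / 2 : ℚ)) ^ 2 = 1 + PowerSeries.X := by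
    rw [sq, ← PowerSeries.binomialSeries_add]
    have h1 := PowerSeries.binomialSeries_nat (R := ℚ) (A := ℚ) 1
    norm_num at h1 ⊢
    exact h1
  rw [sqrtOneSubFourX, binomPow, ← map_pow, h, map_add, map_one, PowerSeries.rescale_X]
  have h4 : (4 : ℚ⟦X⟧) = PowerSeries.C 4 := (map_ofNat PowerSeries.C 4).symm
  rw [h4]
  simp [sub_eq_add_neg]

theorem bonaDenom_ne_zero : (bonaDenom : ℚ⸨X⸩) ≠ 0 := by
  have h : PowerSeries.coeff 1 bonaDenom = 32 := by
    have h8 : (8 : ℚ⟦X⟧) = PowerSeries.C 8 := (map_ofNat PowerSeries.C 8).symm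
    have h20 : (20 : ℚ⟦X⟧) = PowerSeries.C 20 := (map_ofNat PowerSeries.C 20).symm
    rw [bonaDenom, h8, h20]
    simp [binomPow, PowerSeries.coeff_X_pow, PowerSeries.coeff_one]
    norm_num
  intro h0
  have h1 : bonaDenom = 0 := HahnSeries.ofPowerSeries_injective (Γ := ℤ) (by simpa using h0)
  rw [h1] at h
  norm_num at h

end IndecPerm

open IndecPerm

/-!
The proof joins a decomposition, a generating tree and the solution of a functional equation.

Decomposition. If `σ = ρ ⊕ 1`, where `ρ` is 231 or 312, then a direct sum `α ⊕ β` with `β` nonempty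
avoids `σ` if and only if `α` avoids `ρ` and `β` avoids `σ`. A decomposable permutation is uniquely
`α ⊕ β` with `α` indecomposable, and its descent number is the sum of those of `α` and `β`; this
gives the relations between the descent generating functions (`avoidGF₂_eq`). The class of 231 is
closed under direct sums, and its indecomposable members are those which begin with their maximum
(`indecomposable_iff_of_avoids_231`). Hence its series `A` satisfies `A = 1 + x A²`, that of its
indecomposable members is `x A`, and `1 - x A = (1 + √(1 - 4x)) / 2`.

Generating tree. A permutation avoiding 2314 arises uniquely by inserting the maximum into a smaller
one, at a site inside its longest prefix that avoids 231. The further growth depends only on the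
sizes of the sum-indecomposable components of this prefix (`HasState.insertAt_child`), because the
components begin with their maxima. So these permutations are counted by walks on lists of positive
integers (`avoidCount_2314`). Cutting a walk at the last step that changes the first list entry
(`walkSum_last_bottom_change`) leads to an equation with one catalytic variable `u` which marks the
total size (`walkGF_functional_equation`). With `g = G(x, 1)` it reads
`g (1 - u) (G - 1) - x u g G + x u² G² = 0`.

Solution. The equation has only one solution with constant term `1` (`kernel_equation_unique`). Let
`x = d - 2 d²` and let `C = 1 + d (1 - d) u C²` be a Catalan series; then
`G = C (1 - d C) / (1 - d)` is a solution, and it gives `g = (1 - 2d) / (1 - d)³` (`evalOne_walkGF`).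
Written in terms of `√(1 - 8x) = 1 - 4d`, this is `F(x)`, and extraction of coefficients gives `F_n`.
The patterns 3124 and 1342 follow by inversion and reverse-complement.
-/

namespace IndecPerm

/-! ### Walks on lists of block sizes -/

/-- The successors of a state. A state is a list of positive block sizes; it has one successor for
each `j ≤ L.sum`. If `j` is a boundary between blocks (or an end), the blocks after `j` are merged,
together with one new cell, into a single block. If `j` is inside a block, that block is cut at `j`,
everything after the cut is dropped, and a new block of size `1` is put at the end. -/
def child : List ℕ → ℕ → List ℕ
  | [], _ => [1]
  | s :: L, j => if j = 0 then [s + L.sum + 1] else if j < s then [j, 1] else s :: child L (j - s)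

theorem child_pos {L : List ℕ} (hL : ∀ s ∈ L, 0 < s) (j : ℕ) : ∀ s ∈ child L j, 0 < s := by
  induction L generalizing j with
  | nil => simp [child]
  | cons s L ih =>
    have h1 := ih (fun t ht => hL t (List.mem_cons_of_mem _ ht)) (j - s)
    have h2 := hL s List.mem_cons_self
    intro t ht
    rw [child] at ht
    split_ifs at ht with h3 h4
    · simp at ht; omega
    · simp at ht; omega
    · rcases List.mem_cons.1 ht with h | h
      · omega
      · exact h1 t h

section Walks
variable {R : Type*} [CommRing R]

/-- The sum of `φ` over all successors of a state, as an operator on functions of the state. -/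
def stepSum : (List ℕ → R) →ₗ[R] (List ℕ → R) where
  toFun φ L := ∑ j ∈ Finset.range (L.sum + 1), φ (child L j)
  map_add' φ ψ := by ext L; simp [Finset.sum_add_distrib]
  map_smul' c φ := by ext L; simp [Finset.mul_sum]

theorem stepSum_apply (φ : List ℕ → R) (L : List ℕ) :
    stepSum φ L = ∑ j ∈ Finset.range (L.sum + 1), φ (child L j) := rfl

/-- The sum of `φ` over the end points, with multiplicity, of all walks of `n` steps that start at
the empty state. -/
def walkSum : ℕ → (List ℕ → R) →ₗ[R] R
  | 0 => LinearMap.proj []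
  | n + 1 => (walkSum n).comp stepSum

theorem walkSum_zero (φ : List ℕ → R) : walkSum 0 φ = φ [] := rfl

theorem walkSum_succ (n : ℕ) (φ : List ℕ → R) : walkSum (n + 1) φ = walkSum n (stepSum φ) := rfl

theorem walkSum_congr (n : ℕ) {φ ψ : List ℕ → R}
    (h : ∀ L : List ℕ, (∀ s ∈ L, 0 < s) → φ L = ψ L) : walkSum n φ = walkSum n ψ := by
  induction n generalizing φ ψ with
  | zero => exact h [] (by simp)
  | succ n ih =>
    rw [walkSum_succ, walkSum_succ]
    refine ih fun L hL => ?_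
    rw [stepSum_apply, stepSum_apply]
    exact Finset.sum_congr rfl fun j _ => h _ (child_pos hL j)

theorem map_walkSum {S : Type*} [CommRing S] (f : R →+* S) (n : ℕ) (φ : List ℕ → R) :
    f (walkSum n φ) = walkSum n fun L => f (φ L) := by
  induction n generalizing φ with
  | zero => rfl
  | succ n ih =>
    rw [walkSum_succ, walkSum_succ, ih]
    congr 1
    ext L
    simp [stepSum_apply]

theorem stepSum_nil (φ : List ℕ → R) : stepSum φ [] = φ [1] := by simp [stepSum_apply, child]

theorem stepSum_cons (φ : List ℕ → R) {s : ℕ} (hs : 0 < s) (L : List ℕ) :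
    stepSum φ (s :: L) = φ [s + L.sum + 1] + ∑ t ∈ Finset.Ico 1 s, φ [t, 1]
      + stepSum (fun K => φ (s :: K)) L := by
  have h : Finset.range ((s :: L).sum + 1) = Finset.Ico 0 (s + (L.sum + 1)) := by
    rw [List.sum_cons, Finset.range_eq_Ico, add_assoc]
  rw [stepSum_apply, h, ← Finset.sum_Ico_consecutive _ (Nat.zero_le 1) (by omega),
    ← Finset.sum_Ico_consecutive _ (show 1 ≤ s from hs) (by omega), ← add_assoc]
  congr 1
  · congr 1
    · simp [child]
    · refine Finset.sum_congr rfl fun t ht => ?_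
      rw [Finset.mem_Ico] at ht
      simp [child, show t ≠ 0 by omega, ht.2]
  · rw [stepSum_apply, Finset.sum_Ico_eq_sum_range]
    simp only [add_tsub_cancel_left]
    refine Finset.sum_congr rfl fun t ht => ?_
    simp [child, hs.ne']

/-- Decomposition of a nonempty walk at the last step that changes the first block. Either all
blocks are merged by this step, and the walk continues above the new first block as a walk from the
empty state; or the first block is cut down to `t`, and a block `1` is put above it. In the second
case that block counts as the first step of the continuation, because the empty state has `[1]` as its
only successor: this is why `p.2 + 1` steps occur there. -/
theorem walkSum_last_bottom_change (n : ℕ) (φ : List ℕ → R) :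
    walkSum (n + 1) φ = ∑ p ∈ Finset.HasAntidiagonal.antidiagonal n, walkSum p.1 fun L =>
      walkSum p.2 (fun K => φ ((L.sum + 1) :: K))
        + ∑ t ∈ Finset.Ico 1 (L.headD 0), walkSum (p.2 + 1) fun K => φ (t :: K) := by
  induction n generalizing φ with
  | zero => simp [walkSum_succ, walkSum_zero, stepSum_nil]
  | succ n ih =>
    -- `χ` collects the steps that change the first block, `ψ` the steps that keep it.
    let χ : List ℕ → R := fun L => φ [L.sum + 1] + ∑ t ∈ Finset.Ico 1 (L.headD 0), φ [t, 1]
    let ψ : List ℕ → R := fun L => match L with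
      | [] => 0
      | s :: K => stepSum (fun K => φ (s :: K)) K
    have h : walkSum (n + 2) φ = walkSum (n + 1) χ + walkSum (n + 1) ψ := by
      rw [walkSum_succ, ← map_add]
      refine walkSum_congr _ fun L hL => ?_
      cases L with
      | nil => simp [χ, ψ, stepSum_nil]
      | cons s K =>
        rw [stepSum_cons φ (hL s List.mem_cons_self) K]
        simp [χ, ψ]
    rw [h, Finset.Nat.sum_antidiagonal_succ', ih ψ]
    congr 1
    refine walkSum_congr _ fun L _ => ?_
    simp [χ, walkSum_succ, walkSum_zero, stepSum_nil]

end Walks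

/-- The generating function of the walks from the empty state: `x` marks the steps and `u`, the
variable of `ℚ[X]`, marks the total size of the final state. -/
noncomputable def walkGF : ℚ[X]⟦X⟧ :=
  PowerSeries.mk fun n => walkSum n fun L => Polynomial.X ^ L.sum

/-- The substitution `u = 1`. -/
noncomputable def evalOne : ℚ[X]⟦X⟧ →+* ℚ⟦X⟧ := PowerSeries.map (Polynomial.evalRingHom 1)

/-- The inclusion of the series that do not involve `u`. -/
noncomputable def constU : ℚ⟦X⟧ →+* ℚ[X]⟦X⟧ := PowerSeries.map Polynomial.C

theorem coeff_constU_evalOne_walkGF (n : ℕ) :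
    PowerSeries.coeff n (constU (evalOne walkGF)) = walkSum n fun _ => 1 := by
  simp only [constU, evalOne, walkGF, PowerSeries.coeff_map, PowerSeries.coeff_mk, map_walkSum]
  simp

/-- The functional equation of the walks, with catalytic variable `u`. It results from eliminating
two auxiliary series: `J`, in which `u` marks the size of the first block of the final state, and
`q`, in which `u` marks the size to which the first block is cut. -/
theorem walkGF_functional_equation :
    constU (evalOne walkGF) * (1 - PowerSeries.C Polynomial.X) * (walkGF - 1)
      - PowerSeries.X * PowerSeries.C Polynomial.X * constU (evalOne walkGF) * walkGF
      + PowerSeries.X * PowerSeries.C Polynomial.X ^ 2 * walkGF ^ 2 = 0 := by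
  set g := constU (evalOne walkGF) with hg
  set G := walkGF with hG
  set u : ℚ[X]⟦X⟧ := PowerSeries.C Polynomial.X with hu
  let J : ℚ[X]⟦X⟧ := PowerSeries.mk fun n => walkSum n fun L => match L with
    | [] => 0
    | s :: _ => Polynomial.X ^ s
  let q : ℚ[X]⟦X⟧ := PowerSeries.mk fun n => walkSum n fun L =>
    ∑ t ∈ Finset.Ico 1 (L.headD 0), Polynomial.X ^ t
  have hG1 : ∀ n, PowerSeries.coeff n G = walkSum n fun L => Polynomial.X ^ L.sum := by
    simp [hG, walkGF]
  have hg1 : ∀ n, PowerSeries.coeff n g = walkSum n fun _ => 1 := coeff_constU_evalOne_walkGF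
  have zero1 : ∀ n, walkSum n (fun _ => (0 : ℚ[X])) = 0 := fun n => map_zero (walkSum n)
  have smul1 : ∀ (n : ℕ) (c : ℚ[X]) (φ : List ℕ → ℚ[X]),
      walkSum n (fun L => c * φ L) = c * walkSum n φ := fun n c φ => map_smul (walkSum n) c φ
  have smul2 : ∀ (n : ℕ) (c : ℚ[X]) (φ : List ℕ → ℚ[X]),
      walkSum n (fun L => φ L * c) = walkSum n φ * c := fun n c φ => by
    simpa only [mul_comm _ c] using smul1 n c φ
  have smul3 : ∀ (n : ℕ) (c : ℚ[X]), walkSum n (fun _ => c) = c * walkSum n fun _ => 1 :=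
    fun n c => by simpa using smul1 n c fun _ => 1
  have add1 : ∀ (n : ℕ) (φ ψ : List ℕ → ℚ[X]),
      walkSum n (fun L => φ L + ψ L) = walkSum n φ + walkSum n ψ :=
    fun n φ ψ => map_add (walkSum n) φ ψ
  have sub1 : ∀ (n : ℕ) (φ ψ : List ℕ → ℚ[X]),
      walkSum n (fun L => φ L - ψ L) = walkSum n φ - walkSum n ψ :=
    fun n φ ψ => map_sub (walkSum n) φ ψ
  have e1 : G = 1 + PowerSeries.X * (u * G * G + q * PowerSeries.mk fun n =>
      PowerSeries.coeff (n + 1) G) := by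
    ext1 n
    cases n with
    | zero => simp [hG1, walkSum_zero]
    | succ n =>
      rw [map_add, PowerSeries.coeff_succ_X_mul, hG1, walkSum_last_bottom_change, map_add,
        mul_assoc u, hu, PowerSeries.coeff_C_mul, PowerSeries.coeff_mul, PowerSeries.coeff_mul,
        Finset.mul_sum, ← Finset.sum_add_distrib, PowerSeries.coeff_one, if_neg n.succ_ne_zero,
        zero_add]
      refine Finset.sum_congr rfl fun p _ => ?_
      simp only [List.sum_cons, pow_add, smul1, add1, smul2, ← Finset.sum_mul, hG1, q,
        PowerSeries.coeff_mk]
      ring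
  have e2 : J = PowerSeries.X * (u * G * g + q * PowerSeries.mk fun n =>
      PowerSeries.coeff (n + 1) g) := by
    ext1 n
    cases n with
    | zero => simp [J, walkSum_zero]
    | succ n =>
      simp only [J]
      rw [PowerSeries.coeff_succ_X_mul, PowerSeries.coeff_mk, walkSum_last_bottom_change, map_add,
        mul_assoc u, hu, PowerSeries.coeff_C_mul, PowerSeries.coeff_mul, PowerSeries.coeff_mul,
        Finset.mul_sum, ← Finset.sum_add_distrib]
      refine Finset.sum_congr rfl fun p _ => ?_
      simp only [smul3 _ (_ ^ _), pow_add, smul1, add1, smul2, ← Finset.sum_mul, hG1, hg1, q,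
        PowerSeries.coeff_mk]
      ring
  have hshift : ∀ f : ℚ[X]⟦X⟧, PowerSeries.coeff 0 f = 1 →
      PowerSeries.X * (PowerSeries.mk fun n => PowerSeries.coeff (n + 1) f) = f - 1 := by
    intro f hf
    ext1 n
    cases n with
    | zero => rw [map_sub, hf]; simp
    | succ n => simp [PowerSeries.coeff_succ_X_mul, PowerSeries.coeff_one]
  have hsG := hshift G (by simp [hG1, walkSum_zero])
  have hsg := hshift g (by rw [hg1, walkSum_zero])
  have e3 : (1 - u) * q = u * (g - 1) - J := by
    have h1 : g - 1 = PowerSeries.mk fun n => walkSum n fun L => if L = [] then 0 else 1 := by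
      ext1 n
      have : PowerSeries.coeff n (1 : ℚ[X]⟦X⟧) = walkSum n fun L => if L = [] then 1 else 0 := by
        cases n with
        | zero => simp [walkSum_zero]
        | succ n => rw [walkSum_last_bottom_change]; simp [PowerSeries.coeff_one, zero1]
      rw [map_sub, hg1, PowerSeries.coeff_mk, this, ← sub1]
      congr 1
      ext1 L
      split_ifs <;> simp
    ext1 n
    rw [h1, sub_mul, one_mul, map_sub, map_sub, hu, PowerSeries.coeff_C_mul,
      PowerSeries.coeff_C_mul]
    simp only [q, J, PowerSeries.coeff_mk]
    rw [← smul1, ← smul1, ← sub1, ← sub1]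
    refine walkSum_congr n fun L hL => ?_
    cases L with
    | nil => simp
    | cons s K =>
      have hs : 1 ≤ s := hL s List.mem_cons_self
      have := Finset.sum_Ico_consecutive (fun t => (Polynomial.X : ℚ[X]) ^ t) (Nat.zero_le 1) hs
      have h3 := geom_sum_mul (Polynomial.X : ℚ[X]) s
      rw [Finset.range_eq_Ico, ← this] at h3
      simp at h3 ⊢
      linear_combination -h3
  have e1' : G = 1 + PowerSeries.X * u * G ^ 2 + q * (G - 1) := by
    linear_combination e1 + q * hsG
  have e2' : J = PowerSeries.X * u * G * g + q * (g - 1) := by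
    linear_combination e2 + q * hsg
  clear_value J q
  linear_combination (g - u) * e1' + (G - 1) * (e3 - e2')

/-! ### Solution of the functional equation -/

theorem evalOne_C (p : ℚ[X]) : evalOne (PowerSeries.C p) = PowerSeries.C (p.eval 1) := by
  simp [evalOne]

theorem evalOne_constU (f : ℚ⟦X⟧) : evalOne (constU f) = f := by
  ext n; simp [evalOne, constU]

theorem constantCoeff_map {R S : Type*} [CommRing R] [CommRing S] (f : R →+* S) (φ : R⟦X⟧) :
    PowerSeries.constantCoeff (PowerSeries.map f φ) = f (PowerSeries.constantCoeff φ) := by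
  rw [← PowerSeries.coeff_zero_eq_constantCoeff_apply, PowerSeries.coeff_map,
    PowerSeries.coeff_zero_eq_constantCoeff_apply]

/-- The functional equation determines its solution: the terms of order less than `n` in `x` fix
`(1 - u)` times the term of order `n`. -/
theorem kernel_equation_unique {G H : ℚ[X]⟦X⟧} (hG0 : PowerSeries.constantCoeff G = 1)
    (hH0 : PowerSeries.constantCoeff H = 1)
    (hG : constU (evalOne G) * (1 - PowerSeries.C Polynomial.X) * (G - 1)
      - PowerSeries.X * PowerSeries.C Polynomial.X * constU (evalOne G) * G
      + PowerSeries.X * PowerSeries.C Polynomial.X ^ 2 * G ^ 2 = 0)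
    (hH : constU (evalOne H) * (1 - PowerSeries.C Polynomial.X) * (H - 1)
      - PowerSeries.X * PowerSeries.C Polynomial.X * constU (evalOne H) * H
      + PowerSeries.X * PowerSeries.C Polynomial.X ^ 2 * H ^ 2 = 0) : G = H := by
  have key : ∀ n : ℕ, (PowerSeries.X : ℚ[X]⟦X⟧) ^ n ∣ G - H := by
    intro n
    induction n with
    | zero => simp
    | succ n ih =>
      obtain ⟨D, hD⟩ := ih
      have hX : constU (evalOne (PowerSeries.X : ℚ[X]⟦X⟧)) = PowerSeries.X := by
        simp [constU, evalOne]
      have hd : constU (evalOne G) - constU (evalOne H)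
          = PowerSeries.X ^ n * constU (evalOne D) := by
        rw [← map_sub, ← map_sub, hD, map_mul, map_mul, map_pow, map_pow, hX]
      obtain ⟨K, hK⟩ : (PowerSeries.X : ℚ[X]⟦X⟧) ∣ H - 1 := by
        rw [PowerSeries.X_dvd_iff]; simp [hH0]
      have hu : IsUnit (constU (evalOne G)) := by
        rw [PowerSeries.isUnit_iff_constantCoeff]
        simp [constU, evalOne, constantCoeff_map, hG0]
      generalize constU (evalOne G) = g at *
      generalize constU (evalOne H) = h at *
      generalize constU (evalOne D) = δ at *
      set u : ℚ[X]⟦X⟧ := PowerSeries.C Polynomial.X with hudef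
      have h1 : (PowerSeries.X : ℚ[X]⟦X⟧) ^ (n + 1) ∣ g * ((1 - u) * (G - H)) :=
        ⟨-(1 - u) * δ * K + u * (g * D + δ * H) - u ^ 2 * D * (G + H), by
          linear_combination hG - hH - (1 - u) * (H - 1) * hd
            - PowerSeries.X ^ n * δ * (1 - u) * hK
            + PowerSeries.X * u * (g * hD + H * hd)
            - PowerSeries.X * u ^ 2 * (G + H) * hD⟩
      have h2 := (hu.dvd_mul_left).1 h1
      rw [PowerSeries.X_pow_dvd_iff] at h2 ⊢
      intro m hm
      have h3 := h2 m hm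
      rw [sub_mul, one_mul, map_sub, hudef, PowerSeries.coeff_C_mul, ← one_sub_mul] at h3
      refine (mul_eq_zero.1 h3).resolve_left ?_
      intro h4
      have := congrArg (Polynomial.eval 0) h4
      simp at this
  rw [← sub_eq_zero]
  ext1 n
  exact PowerSeries.X_pow_dvd_iff.1 (key (n + 1)) n n.lt_succ_self

/-- The Catalan series, composed with `z`. -/
theorem exists_catalan_fixpoint {R : Type*} [CommRing R] (z : R⟦X⟧)
    (hz : PowerSeries.constantCoeff z = 0) :
    ∃ C : R⟦X⟧, C = 1 + z * C ^ 2 ∧ PowerSeries.constantCoeff C = 1 := by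
  let c : R⟦X⟧ := PowerSeries.map (Nat.castRingHom R) PowerSeries.catalanSeries
  have hc : c ^ 2 * PowerSeries.X + 1 = c := by
    have := congrArg (PowerSeries.map (Nat.castRingHom R))
      PowerSeries.catalanSeries_sq_mul_X_add_one
    simpa using this
  have hs : PowerSeries.HasSubst z := PowerSeries.HasSubst.of_constantCoeff_zero' hz
  have h := congrArg (PowerSeries.substAlgHom hs) hc
  rw [map_add, map_mul, map_pow, map_one, PowerSeries.substAlgHom_X] at h
  refine ⟨PowerSeries.substAlgHom hs c, ?_, ?_⟩
  · linear_combination -h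
  · have h2 := congrArg PowerSeries.constantCoeff h
    simpa [hz] using h2.symm

theorem sqrt_mul_three_halves (c : ℚ) : binomPow c (1 / 2) ^ 3 = binomPow c (3 / 2) := by
  rw [binomPow, binomPow, ← map_pow, pow_succ, sq, ← PowerSeries.binomialSeries_add,
    ← PowerSeries.binomialSeries_add]
  norm_num

theorem sqrt_sq (c : ℚ) : binomPow c (1 / 2) ^ 2 = 1 + PowerSeries.C c * PowerSeries.X := by
  have h : (PowerSeries.binomialSeries ℚ (1 / 2 : ℚ)) ^ 2 = 1 + PowerSeries.X := by
    rw [sq, ← PowerSeries.binomialSeries_add]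
    have h1 := PowerSeries.binomialSeries_nat (R := ℚ) (A := ℚ) 1
    norm_num at h1 ⊢
    exact h1
  rw [binomPow, ← map_pow, h, map_add, map_one, PowerSeries.rescale_X]

theorem constantCoeff_binomPow (c r : ℚ) : PowerSeries.constantCoeff (binomPow c r) = 1 := by
  rw [← PowerSeries.coeff_zero_eq_constantCoeff_apply, binomPow, PowerSeries.coeff_rescale]
  simp

/-- The series `d = (1 - √(1 - 8x)) / 4`, which satisfies `d - 2 d² = x`. All the series of the
enumeration are rational in `d`. -/
noncomputable def bicubicD : ℚ⟦X⟧ := PowerSeries.C (1 / 4) * (1 - binomPow (-8) (1 / 2))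

theorem binomPow_eq_bicubicD : binomPow (-8) (1 / 2) = 1 - 4 * bicubicD := by
  have : (4 : ℚ⟦X⟧) * PowerSeries.C (1 / 4) = 1 := by
    rw [← map_ofNat PowerSeries.C 4, ← map_mul]; norm_num
  rw [bicubicD]
  linear_combination (1 - binomPow (-8) (1 / 2)) * this

theorem X_eq_bicubicD : (PowerSeries.X : ℚ⟦X⟧) = bicubicD - 2 * bicubicD ^ 2 := by
  have h := sqrt_sq (-8)
  rw [binomPow_eq_bicubicD, map_neg,
    show PowerSeries.C (8 : ℚ) = 8 from map_ofNat PowerSeries.C 8] at h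
  have h8 : (8 : ℚ⟦X⟧) ≠ 0 := fun h0 => by
    have := congrArg PowerSeries.constantCoeff h0
    rw [map_ofNat] at this
    norm_num at this
  apply mul_left_cancel₀ h8
  linear_combination h

theorem constantCoeff_bicubicD : PowerSeries.constantCoeff bicubicD = 0 := by
  simp [bicubicD, constantCoeff_binomPow]

theorem constantCoeff_walkGF : PowerSeries.constantCoeff walkGF = 1 := by
  rw [← PowerSeries.coeff_zero_eq_constantCoeff_apply, walkGF, PowerSeries.coeff_mk, walkSum_zero]
  simp

/-- The number series of the walks is `(1 - 2d) / (1 - d)³`. The full solution of the functional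
equation is `C (1 - d C) / (1 - d)`, where `C = 1 + d (1 - d) u C²`; at `u = 1` the series `C`
becomes `1 / (1 - d)`. -/
theorem evalOne_walkGF : (1 - bicubicD) ^ 3 * evalOne walkGF = 1 - 2 * bicubicD := by
  set d := bicubicD with hd
  have hd0 : PowerSeries.constantCoeff d = 0 := constantCoeff_bicubicD
  obtain ⟨w, hw⟩ : ∃ w : ℚ⟦X⟧, (1 - d) * w = 1 := by
    have : IsUnit (1 - d) := by
      rw [PowerSeries.isUnit_iff_constantCoeff]; simp [hd0]
    exact this.exists_right_inv
  set e : ℚ[X]⟦X⟧ := constU d with he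
  set v : ℚ[X]⟦X⟧ := constU w with hv
  have hev : (1 - e) * v = 1 := by
    rw [he, hv, ← map_one constU, ← map_sub, ← map_mul, hw]
  have he0 : PowerSeries.constantCoeff e = 0 := by simp [he, constU, constantCoeff_map, hd0]
  have hv0 : PowerSeries.constantCoeff v = 1 := by
    have := congrArg PowerSeries.constantCoeff hev
    simpa [he0] using this
  have hx : (PowerSeries.X : ℚ[X]⟦X⟧) = e - 2 * e ^ 2 := by
    have := congrArg constU X_eq_bicubicD
    rw [map_sub, map_mul, map_pow, map_ofNat constU 2] at this
    simpa [constU, he, hd] using this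
  obtain ⟨C, hC, hC0⟩ := exists_catalan_fixpoint (e * (1 - e) * PowerSeries.C Polynomial.X)
    (by simp [he0])
  -- The explicit solution; `v` is the inverse of `1 - d`.
  set H : ℚ[X]⟦X⟧ := v * (C * (1 - e * C)) with hH
  have hH0 : PowerSeries.constantCoeff H = 1 := by simp [hH, hv0, hC0, he0]
  have hC1 : evalOne C = w := by
    have h1 := congrArg evalOne hC
    have hc0 : PowerSeries.constantCoeff (evalOne C) = 1 := by
      rw [evalOne, ← PowerSeries.coeff_zero_eq_constantCoeff_apply, PowerSeries.coeff_map,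
        PowerSeries.coeff_zero_eq_constantCoeff_apply, hC0]
      simp
    simp only [map_add, map_mul, map_sub, map_one, map_pow, evalOne_C, Polynomial.eval_X, he,
      evalOne_constU] at h1
    have h2 : (evalOne C - w) * (1 - d * (1 - d) * (evalOne C + w)) = 0 := by
      linear_combination h1 + (d * w - 1) * hw
    refine sub_eq_zero.1 ((mul_eq_zero.1 h2).resolve_right fun h3 => ?_)
    have := congrArg PowerSeries.constantCoeff h3
    simp [hd0] at this
  have hHe : evalOne H = w ^ 3 * (1 - 2 * d) := by
    rw [hH, map_mul, map_mul, map_sub, map_mul, hC1, hv, he, evalOne_constU, evalOne_constU,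
      map_one]
    linear_combination (- w ^ 2) * hw
  have hcg : constU (evalOne H) = v ^ 3 * (1 - 2 * e) := by
    rw [hHe]; simp [hv, he, map_ofNat constU 2]
  have hu : walkGF = H := by
    refine kernel_equation_unique constantCoeff_walkGF hH0 walkGF_functional_equation ?_
    rw [hcg, hH, hx]
    set u : ℚ[X]⟦X⟧ := PowerSeries.C Polynomial.X
    have hune : (1 - e) ^ 4 ≠ 0 := by
      intro h0
      have := congrArg PowerSeries.constantCoeff h0
      simp [he0] at this
    have p2 : (1 - e) ^ 4 * v ^ 2 = (1 - e) ^ 2 := by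
      linear_combination (1 - e) ^ 2 * ((1 - e) * v + 1) * hev
    have p3 : (1 - e) ^ 4 * v ^ 3 = 1 - e := by
      linear_combination v * p2 + (1 - e) * hev
    have p4 : (1 - e) ^ 4 * v ^ 4 = 1 := by
      linear_combination v * p3 + hev
    apply mul_left_cancel₀ hune
    set B := C * (1 - e * C) with hB
    linear_combination (1 - 2 * e) * B * ((1 - u) - (e - 2 * e ^ 2) * u) * p4
      - (1 - 2 * e) * (1 - u) * p3 + (e - 2 * e ^ 2) * u ^ 2 * B ^ 2 * p2
      + (1 - 2 * e) * ((1 - e - e * C) - u * (1 - e) * (1 - e * C) ^ 2) * hC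
  rw [hu, hHe]
  linear_combination (1 - 2 * d) * ((1 - d) ^ 2 * w ^ 2 + (1 - d) * w + 1) * hw

/-! ### The closed formula -/

theorem walkGF_mul_bonaDenom : evalOne walkGF * bonaDenom = 32 * PowerSeries.X := by
  rw [bonaDenom, ← sqrt_mul_three_halves, binomPow_eq_bicubicD, X_eq_bicubicD]
  linear_combination 32 * bicubicD * evalOne_walkGF

theorem coe_walkGF_eq_bonaF : ((evalOne walkGF : ℚ⟦X⟧) : ℚ⸨X⸩) = bonaF := by
  rw [bonaF, eq_div_iff bonaDenom_ne_zero, ← walkGF_mul_bonaDenom]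
  push_cast
  rfl

theorem ringChoose_succ (r : ℚ) (n : ℕ) :
    ((n : ℚ) + 1) * Ring.choose r (n + 1) = (r - n) * Ring.choose r n := by
  rw [Ring.choose_eq_smul, Ring.choose_eq_smul, descPochhammer_succ_right, Polynomial.smeval_mul]
  simp [Polynomial.smeval_sub, Nat.factorial_succ, Polynomial.smeval_X, Polynomial.smeval_natCast]
  field_simp

theorem coeff_binomPow_three_halves (j : ℕ) :
    PowerSeries.coeff (j + 2) (binomPow (-8) (3 / 2))
      = 6 * 2 ^ (j + 3) * ((2 * j).factorial / ((j + 2).factorial * j.factorial)) := by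
  simp only [binomPow, PowerSeries.coeff_rescale, PowerSeries.binomialSeries_coeff, smul_eq_mul,
    mul_one]
  induction j with
  | zero =>
    have h1 := ringChoose_succ (3 / 2) 1
    rw [Ring.choose_one_right] at h1
    norm_num [Nat.factorial] at h1 ⊢
    linarith
  | succ j ih =>
    have h := ringChoose_succ (3 / 2) (j + 2)
    have hj : ((j : ℚ) + 3) ≠ 0 := by positivity
    push_cast at h
    have h' : Ring.choose (3 / 2 : ℚ) (j + 1 + 2)
        = (3 / 2 - (j + 2)) * Ring.choose (3 / 2 : ℚ) (j + 2) / (j + 3) := by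
      rw [eq_div_iff hj]; linear_combination h
    rw [h', show 2 * (j + 1) = 2 * j + 1 + 1 by ring, show j + 1 + 2 = j + 2 + 1 by ring,
      Nat.factorial_succ (2 * j + 1), Nat.factorial_succ (2 * j), Nat.factorial_succ (j + 2),
      Nat.factorial_succ j, pow_succ]
    have e : (-8 : ℚ) ^ (j + 2) * -8
        * ((3 / 2 - (j + 2)) * Ring.choose (3 / 2 : ℚ) (j + 2) / (j + 3))
      = 4 * (2 * j + 1) / (j + 3) * ((-8 : ℚ) ^ (j + 2) * Ring.choose (3 / 2 : ℚ) (j + 2)) := by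
      field_simp; ring
    rw [e, ih]
    push_cast
    field_simp
    ring

/-- Since `1 + x = (1 - d) (1 + 2d)`, the number series is
`(1 - 2d) (1 + 2d)³ / (1 + x)³ = (1 + 20x - 8x² + (1 - 8x)^{3/2}) / (2 (1 + x)³)`. The closed
formula is the coefficient of the product with `(1 + x)⁻³`; its polynomial part collects the
contribution of the terms of `(1 - 8x)^{3/2}` of order `0` and `1`. -/
theorem coeff_walkGF_eq_bonaNumber {n : ℕ} (hn : 1 ≤ n) :
    PowerSeries.coeff n (evalOne walkGF) = bonaNumber n := by
  let c : ℚ⟦X⟧ := PowerSeries.mk fun n => (-1) ^ n * ((n + 2).choose 2 : ℚ)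
  have hc : c * (1 + PowerSeries.X) ^ 3 = 1 := by
    have h1 : ∀ f : ℕ → ℚ, (PowerSeries.mk f) * (1 + PowerSeries.X)
        = PowerSeries.mk fun n => f n + if n = 0 then 0 else f (n - 1) := by
      intro f
      ext n
      cases n with
      | zero => simp
      | succ n => simp [mul_add, PowerSeries.coeff_succ_mul_X]
    rw [pow_succ, sq, ← mul_assoc, ← mul_assoc, h1, h1, h1]
    ext n
    rw [PowerSeries.coeff_mk, PowerSeries.coeff_one]
    rcases n with _ | _ | _ | n
    · simp
    · simp; norm_num
    · simp [Nat.choose]; norm_num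
    · simp only [Nat.cast_choose_two]
      simp [pow_succ]
      ring
  have h2 : 2 * (evalOne walkGF * (1 + PowerSeries.X) ^ 3)
      = 1 + 20 * PowerSeries.X - 8 * PowerSeries.X ^ 2 + binomPow (-8) (3 / 2) := by
    rw [← sqrt_mul_three_halves, binomPow_eq_bicubicD, X_eq_bicubicD]
    linear_combination 2 * (1 + 2 * bicubicD) ^ 3 * evalOne_walkGF
  have h3 : 2 * evalOne walkGF
      = (1 + 20 * PowerSeries.X - 8 * PowerSeries.X ^ 2 + binomPow (-8) (3 / 2)) * c := by
    linear_combination c * h2 - 2 * evalOne walkGF * hc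
  have hb0 : PowerSeries.coeff 0 (binomPow (-8) (3 / 2)) = 1 := by
    simpa using constantCoeff_binomPow (-8) (3 / 2)
  have hb1 : PowerSeries.coeff 1 (binomPow (-8) (3 / 2)) = -12 := by
    simp [binomPow, PowerSeries.coeff_rescale]; norm_num
  have h4 := congrArg (PowerSeries.coeff n) h3
  have h20 : (20 : ℚ⟦X⟧) = PowerSeries.C 20 := (map_ofNat PowerSeries.C 20).symm
  have h8 : (8 : ℚ⟦X⟧) = PowerSeries.C 8 := (map_ofNat PowerSeries.C 8).symm
  have h2' : (2 : ℚ⟦X⟧) = PowerSeries.C 2 := (map_ofNat PowerSeries.C 2).symm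
  rw [h2', PowerSeries.coeff_C_mul, add_mul, sub_mul, add_mul, h20, h8, map_add, map_sub, map_add,
    mul_assoc, mul_assoc, PowerSeries.coeff_C_mul, PowerSeries.coeff_C_mul, one_mul] at h4
  have h5 : PowerSeries.coeff n (binomPow (-8) (3 / 2) * c)
      = (-1) ^ n * ((n + 2).choose 2 : ℚ) - 12 * ((-1) ^ (n - 1) * ((n - 1 + 2).choose 2 : ℚ))
        + ∑ i ∈ Finset.Icc 2 n, 6 * ((-1 : ℚ) ^ (n - i) * 2 ^ (i + 1)
          * ((Nat.factorial (2 * i - 4) : ℚ)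
              / ((Nat.factorial i : ℚ) * (Nat.factorial (i - 2) : ℚ)))
          * (Nat.choose (n - i + 2) 2 : ℚ)) := by
    rw [PowerSeries.coeff_mul, Finset.Nat.sum_antidiagonal_eq_sum_range_succ_mk,
      Finset.range_eq_Ico, Finset.sum_eq_sum_Ico_succ_bot (by omega),
      Finset.sum_eq_sum_Ico_succ_bot (by omega), ← add_assoc]
    congr 1
    · simp [hb1, c]
      rw [constantCoeff_binomPow]
      ring
    · refine Finset.sum_congr (by ext; simp) fun i hi => ?_
      obtain ⟨j, rfl⟩ : ∃ j, i = j + 2 := ⟨i - 2, by simp at hi; omega⟩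
      rw [coeff_binomPow_three_halves, show 2 * (j + 2) - 4 = 2 * j by omega]
      simp only [c, PowerSeries.coeff_mk, Nat.add_sub_cancel]
      ring
  have h6 : PowerSeries.coeff n (PowerSeries.X ^ 2 * c)
      = (-1 : ℚ) ^ n * (n * (n - 1) / 2) := by
    rcases n with _ | _ | n
    · simp at hn
    · rw [sq, mul_assoc, PowerSeries.coeff_succ_X_mul]; simp
    · rw [sq, mul_assoc, PowerSeries.coeff_succ_X_mul, PowerSeries.coeff_succ_X_mul]
      simp only [c, PowerSeries.coeff_mk, Nat.cast_choose_two]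
      push_cast; ring
  obtain ⟨m, rfl⟩ : ∃ m, n = m + 1 := ⟨n - 1, by omega⟩
  rw [h5, h6, PowerSeries.coeff_succ_X_mul, ← Finset.mul_sum] at h4
  simp only [c, PowerSeries.coeff_mk, Nat.cast_choose_two, Nat.add_sub_cancel] at h4
  rw [bonaNumber]
  simp only [Nat.cast_choose_two, Nat.add_sub_cancel]
  push_cast at h4 ⊢
  linear_combination h4 / 2

/-! ### Insertion of a maximum into a word avoiding 2314 -/

/-- `b` is a partial sum of the list of block sizes, possibly the empty one or the full one. -/
def IsBreak : List ℕ → ℕ → Prop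
  | [], b => b = 0
  | s :: L, b => b = 0 ∨ (s ≤ b ∧ IsBreak L (b - s))

theorem isBreak_sum (L : List ℕ) : IsBreak L L.sum := by
  induction L with
  | nil => simp [IsBreak]
  | cons s L ih => right; simpa using ih

theorem child_of_isBreak {L : List ℕ} (hL : ∀ s ∈ L, 0 < s) {j : ℕ} (hj : IsBreak L j) :
    (child L j).sum = L.sum + 1 ∧
      ∀ b, IsBreak (child L j) b ↔ (b ≤ j ∧ IsBreak L b) ∨ b = L.sum + 1 := by
  induction L generalizing j with
  | nil =>
    simp only [IsBreak] at hj
    subst hj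
    refine ⟨by simp [child], fun b => ?_⟩
    simp only [child, IsBreak, List.sum_nil]; omega
  | cons s L ih =>
    have hs := hL s List.mem_cons_self
    rcases Nat.eq_zero_or_pos j with rfl | hj0
    · refine ⟨by simp [child], fun b => ?_⟩
      simp only [child, IsBreak, List.sum_cons, if_true]
      constructor
      · rintro (h | h)
        · simp [h]
        · right; omega
      · rintro (h | h)
        · left; omega
        · right; omega
    · rcases hj with hj | ⟨hj1, hj2⟩
      · omega
      obtain ⟨h1, h2⟩ := ih (fun t ht => hL t (List.mem_cons_of_mem _ ht)) hj2
      have hc : child (s :: L) j = s :: child L (j - s) := by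
        rw [child, if_neg (by omega), if_neg (by omega)]
      rw [hc]
      refine ⟨by rw [List.sum_cons, h1, List.sum_cons]; omega, fun b => ?_⟩
      simp only [IsBreak, h2, List.sum_cons]
      by_cases hb : s ≤ b
      · have e1 : b - s ≤ j - s ↔ b ≤ j := by omega
        have e2 : b - s = L.sum + 1 ↔ b = s + L.sum + 1 := by omega
        have e3 : b ≠ 0 := by omega
        rw [e1, e2]; simp [hb, e3]
      · have : ¬ b = s + L.sum + 1 := by omega
        have : b ≤ j := by omega
        simp [*]

theorem child_of_not_isBreak {L : List ℕ} (hL : ∀ s ∈ L, 0 < s) {j : ℕ}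
    (hjL : j ≤ L.sum) (hj : ¬ IsBreak L j) :
    (child L j).sum = j + 1 ∧
      ∀ b, IsBreak (child L j) b ↔ (b < j ∧ IsBreak L b) ∨ b = j ∨ b = j + 1 := by
  induction L generalizing j with
  | nil => simp [IsBreak] at hj hjL; omega
  | cons s L ih =>
    have hj0 : j ≠ 0 := fun h => hj (Or.inl h)
    have hs := hL s List.mem_cons_self
    by_cases hjs : j < s
    · have hc : child (s :: L) j = [j, 1] := by
        rw [child, if_neg (by omega), if_pos (by omega)]
      rw [hc]
      refine ⟨by simp, fun b => ?_⟩
      simp only [IsBreak]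
      constructor
      · rintro (h | h)
        · left; omega
        · right; omega
      · rintro (⟨h, h' | h'⟩ | h) <;> omega
    · have hj2 : ¬ IsBreak L (j - s) := fun h => hj (Or.inr ⟨by omega, h⟩)
      obtain ⟨h1, h2⟩ := ih (fun t ht => hL t (List.mem_cons_of_mem _ ht))
        (by rw [List.sum_cons] at hjL; omega) hj2
      have hc : child (s :: L) j = s :: child L (j - s) := by
        rw [child, if_neg (by omega), if_neg (by omega)]
      rw [hc]
      refine ⟨by rw [List.sum_cons, h1]; omega, fun b => ?_⟩
      simp only [IsBreak, h2]
      by_cases hb : s ≤ b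
      · have e1 : b - s < j - s ↔ b < j := by omega
        have e2 : b - s = j - s ↔ b = j := by omega
        have e4 : b - s = j - s + 1 ↔ b = j + 1 := by omega
        have e3 : b ≠ 0 := by omega
        rw [e1, e2, e4]; simp [hb, e3]
      · have : ¬ b = j + 1 := by omega
        have : ¬ b = j := by omega
        have : b < j := by omega
        simp [*]

/-- The word `w` avoids the pattern 231. -/
def Avoids231 (w : List ℕ) : Prop := ∀ b c a, [b, c, a].Sublist w → a < b → ¬ b < c

/-- The word `w` avoids the pattern 2314. -/
def Avoids2314 (w : List ℕ) : Prop :=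
  ∀ b c a d, [b, c, a, d].Sublist w → a < b → b < c → ¬ c < d

theorem sublist_append_cons {l x y : List ℕ} {N : ℕ} (h : l.Sublist (x ++ N :: y)) :
    l.Sublist (x ++ y) ∨ ∃ l₁ l₂, l = l₁ ++ N :: l₂ ∧ l₁.Sublist x ∧ l₂.Sublist y := by
  obtain ⟨m₁, m₂, rfl, h1, h2⟩ := List.sublist_append_iff.1 h
  rcases List.sublist_cons_iff.1 h2 with h3 | ⟨r, rfl, h3⟩
  · exact Or.inl (h1.append h3)
  · exact Or.inr ⟨m₁, r, rfl, h1, h3⟩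

theorem Avoids231.insert_max {x y : List ℕ} {N : ℕ} (h : Avoids231 (x ++ y))
    (hN : ∀ z ∈ x ++ y, z < N) (hxy : ∀ b ∈ x, ∀ a ∈ y, b < a) : Avoids231 (x ++ N :: y) := by
  intro b c a hs hab hbc
  have hmem : ∀ z ∈ [b, c, a], z ≤ N := fun z hz => by
    have := hs.subset hz
    simp only [List.mem_append, List.mem_cons] at this hN
    rcases this with h | h | h
    · exact (hN z (Or.inl h)).le
    · exact h.le
    · exact (hN z (Or.inr h)).le
  have hc := hmem c (by simp)
  rcases sublist_append_cons hs with h1 | ⟨l₁, l₂, h1, h2, h3⟩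
  · exact h b c a h1 hab hbc
  · rcases l₁ with _ | ⟨p, _ | ⟨q, _ | ⟨r, _ | ⟨t, l₁⟩⟩⟩⟩ <;> simp at h1
    · omega
    · obtain ⟨rfl, rfl, rfl⟩ := h1
      have := hxy b (h2.subset (by simp)) a (h3.subset (by simp))
      omega
    · omega

theorem Avoids2314.insert_max {x y : List ℕ} {N : ℕ} (h : Avoids2314 (x ++ y))
    (hN : ∀ z ∈ x ++ y, z < N) (hx : Avoids231 x) : Avoids2314 (x ++ N :: y) := by
  intro b c a d hs hab hbc hcd
  have hmem : ∀ z ∈ [b, c, a, d], z ≤ N := fun z hz => by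
    have := hs.subset hz
    simp only [List.mem_append, List.mem_cons] at this hN
    rcases this with h | h | h
    · exact (hN z (Or.inl h)).le
    · exact h.le
    · exact (hN z (Or.inr h)).le
  have hd := hmem d (by simp)
  rcases sublist_append_cons hs with h1 | ⟨l₁, l₂, h1, h2, h3⟩
  · exact h b c a d h1 hab hbc hcd
  · rcases l₁ with _ | ⟨p, _ | ⟨q, _ | ⟨r, _ | ⟨t, _ | ⟨t', l₁⟩⟩⟩⟩⟩ <;> simp at h1
    · omega
    · omega
    · omega
    · obtain ⟨rfl, rfl, rfl, -⟩ := h1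
      exact hx _ _ _ h2 hab hbc

theorem Avoids231.sublist {v w : List ℕ} (h : Avoids231 w) (hs : v.Sublist w) : Avoids231 v :=
  fun b c a h1 => h b c a (h1.trans hs)

theorem Avoids2314.sublist {v w : List ℕ} (h : Avoids2314 w) (hs : v.Sublist w) : Avoids2314 v :=
  fun b c a d h1 => h b c a d (h1.trans hs)

theorem Avoids2314.avoids231_left {x y : List ℕ} {N : ℕ} (h : Avoids2314 (x ++ N :: y))
    (hN : ∀ z ∈ x, z < N) : Avoids231 x := by
  intro b c a hs hab hbc
  refine h b c a N ?_ hab hbc (hN c (hs.subset (by simp)))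
  exact (hs.append ((List.nil_sublist y).cons_cons N) :)

/-- `L` is the state of the word `w`: if `p` is the longest prefix of `w` that avoids 231, then `L`
lists the sizes of the sum-indecomposable components of `p`, so that the partial sums of `L` are the
positions `b` at which every entry of `p` before `b` is smaller than every entry after `b`. -/
def HasState (w L : List ℕ) : Prop :=
  ∃ p r, w = p ++ r ∧ p.length = L.sum ∧ Avoids231 p ∧
    (∀ y r', r = y :: r' → ¬ Avoids231 (p ++ [y])) ∧
    ∀ b ≤ p.length, (IsBreak L b ↔ ∀ x ∈ p.take b, ∀ y ∈ p.drop b, x < y)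

/-- The word `w` with the letter `N` inserted after its first `j` letters. -/
def insertAt (w : List ℕ) (j N : ℕ) : List ℕ := w.take j ++ N :: w.drop j

/-- Insertion of a new maximum after `j` letters moves the state to its `j`-th successor. At a
component boundary the new maximum creates no 231, and it merges with everything to its right.
Inside a component the next letter is smaller than some letter before the insertion, since the
prefix avoids 231; so the new longest prefix ends with the new maximum. -/
theorem HasState.insertAt_child {w L : List ℕ} (h : HasState w L) (hL : ∀ s ∈ L, 0 < s)
    (hw : w.Nodup) {N : ℕ} (hN : ∀ z ∈ w, z < N) {j : ℕ} (hj : j ≤ L.sum) :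
    HasState (insertAt w j N) (child L j) := by
  obtain ⟨p, r, rfl, hp, hav, hr, hb⟩ := h
  have hjp : j ≤ p.length := by omega
  have hNp : ∀ z ∈ p, z < N := fun z hz => hN z (by simp [hz])
  have hins : insertAt (p ++ r) j N = p.take j ++ N :: p.drop j ++ r := by
    rw [insertAt, List.take_append_of_le_length hjp, List.drop_append_of_le_length hjp]
    simp
  by_cases hjb : IsBreak L j
  · obtain ⟨h1, h2⟩ := child_of_isBreak hL hjb
    have hsep := (hb j hjp).1 hjb
    refine ⟨p.take j ++ N :: p.drop j, r, hins, by simp; omega, ?_, ?_, ?_⟩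
    · exact Avoids231.insert_max (by simpa using hav) (by simpa using hNp) hsep
    · intro y r' hy h3
      refine hr y r' hy (h3.sublist ?_)
      refine List.Sublist.append ?_ (List.Sublist.refl _)
      conv_lhs => rw [← List.take_append_drop j p]
      exact (List.Sublist.refl _).append (List.sublist_cons_self _ _)
    · intro b hbl
      rw [h2]
      have hlen : (p.take j ++ N :: p.drop j).length = p.length + 1 := by simp; omega
      have htl : (p.take j).length = j := by simp [hjp]
      rcases Nat.lt_or_ge j b with hjb' | hbj
      · have e1 : ¬ b ≤ j := by omega
        obtain ⟨k, rfl⟩ : ∃ k, b = j + 1 + k := ⟨b - j - 1, by omega⟩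
        have e2 : (p.take j ++ N :: p.drop j).take (j + 1 + k)
            = p.take j ++ N :: (p.drop j).take k := by
          rw [List.take_append, htl, List.take_of_length_le (by omega),
            show j + 1 + k - j = k + 1 by omega, List.take_succ_cons]
        have e3 : (p.take j ++ N :: p.drop j).drop (j + 1 + k) = (p.drop j).drop k := by
          rw [List.drop_append, htl, List.drop_eq_nil_of_le (by omega),
            show j + 1 + k - j = k + 1 by omega, List.drop_succ_cons, List.nil_append]
        rw [e2, e3]
        constructor
        · rintro (h | h)
          · omega
          · intro x _ y hy
            rw [List.drop_drop, List.drop_eq_nil_of_le (by omega)] at hy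
            simp at hy
        · intro h
          right
          by_contra hne
          have : (p.drop j).drop k ≠ [] := by
            intro h0
            have := congrArg List.length h0
            simp at this
            omega
          obtain ⟨y, hy⟩ := List.exists_mem_of_ne_nil _ this
          have h4 := h N (by simp) y hy
          have h5 := hNp y ((List.drop_subset _ _) ((List.drop_subset _ _) hy))
          omega
      · have e1 : b ≠ L.sum + 1 := by omega
        have e2 : (p.take j ++ N :: p.drop j).take b = p.take b := by
          rw [List.take_append_of_le_length (by omega), List.take_take, min_eq_left hbj]
        have e3 : (p.take j ++ N :: p.drop j).drop b = (p.take j).drop b ++ N :: p.drop j := by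
          rw [List.drop_append_of_le_length (by omega)]
        have e4 : p.drop b = (p.take j).drop b ++ p.drop j := by
          conv_lhs => rw [← List.take_append_drop j p]
          rw [List.drop_append_of_le_length (by omega)]
        rw [e2, e3]
        simp only [hbj, true_and, e1, or_false]
        rw [hb b (by omega), e4]
        refine forall₂_congr fun x hx => ?_
        have := hNp x (List.take_subset _ _ hx)
        constructor
        · intro h y hy
          rcases List.mem_append.1 hy with hy | hy
          · exact h y (by simp [hy])
          · rcases List.mem_cons.1 hy with rfl | hy
            · exact this
            · exact h y (by simp [hy])
        · intro h y hy
          rcases List.mem_append.1 hy with hy | hy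
          · exact h y (by simp [hy])
          · exact h y (by simp [hy])
  · obtain ⟨h1, h2⟩ := child_of_not_isBreak hL hj hjb
    have hjlt : j < p.length := by
      rcases Nat.lt_or_ge j p.length with h | h
      · exact h
      · exact absurd (by rw [show j = L.sum by omega]; exact isBreak_sum L) hjb
    obtain ⟨y, q, hq⟩ : ∃ y q, p.drop j = y :: q :=
      ⟨p[j], p.drop (j + 1), List.drop_eq_getElem_cons hjlt⟩
    have hpq : p = p.take j ++ y :: q := by rw [← hq, List.take_append_drop]
    have htl : (p.take j).length = j := by simp [hjp]
    have hnd : p.Nodup := hw.of_append_left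
    set t := p.take j with ht
    -- the next entry is below some entry of `t`
    obtain ⟨x, hx, hxy⟩ : ∃ x ∈ t, y < x := by
      have := mt (hb j hjp).2 hjb
      push Not at this
      obtain ⟨x, hx, y', hy', hle⟩ := this
      rw [hq] at hy'
      by_contra hcon
      push Not at hcon
      have hxy := hcon x hx
      rw [hpq] at hnd hav
      rcases List.mem_cons.1 hy' with rfl | hy'
      · have : x ≠ y' := by
          rintro rfl
          exact (List.disjoint_of_nodup_append hnd) hx (by simp)
        omega
      · have n1 : x ≠ y' := by
          rintro rfl
          exact (List.disjoint_of_nodup_append hnd) hx (by simp [hy'])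
        have n2 : x ≠ y := by
          rintro rfl
          exact (List.disjoint_of_nodup_append hnd) hx (by simp)
        refine hav x y y' ?_ (by omega) (by omega)
        exact ((List.singleton_sublist.2 hx).append
          ((List.singleton_sublist.2 hy').cons_cons y) :)
    refine ⟨t ++ [N], y :: q ++ r, ?_, by simp [htl, h1], ?_, ?_, ?_⟩
    · rw [hins, hq]; simp
    · refine Avoids231.insert_max (y := []) ?_ ?_ (by simp)
      · simpa using hav.sublist (List.take_sublist _ _)
      · simpa using fun z hz => hNp z (List.take_subset _ _ hz)
    · intro y' r' hy' h3
      simp only [List.cons_append, List.cons.injEq] at hy'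
      obtain ⟨rfl, -⟩ := hy'
      refine h3 x N y ?_ hxy (hNp x (List.take_subset _ _ hx))
      rw [List.append_assoc]
      exact ((List.singleton_sublist.2 hx).append (List.Sublist.refl [N, y]) :)
    · intro b hbl
      rw [h2]
      simp only [List.length_append, htl, List.length_singleton] at hbl
      rcases Nat.lt_or_ge b j with hbj | hbj
      · have e1 : ¬ b = j := by omega
        have e2 : ¬ b = j + 1 := by omega
        simp only [hbj, true_and, e1, e2, or_false]
        rw [hb b (by omega), List.take_append_of_le_length (by omega),
          List.drop_append_of_le_length (by omega)]
        have e3 : p.take b = t.take b := by rw [ht, List.take_take, min_eq_left hbj.le]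
        have e4 : p.drop b = t.drop b ++ y :: q := by
          conv_lhs => rw [hpq]
          rw [List.drop_append_of_le_length (by omega)]
        rw [e3, e4]
        constructor
        · intro h x hx z hz
          rcases List.mem_append.1 hz with hz | hz
          · exact h x hx z (by simp [hz])
          · rw [List.mem_singleton.1 hz]
            exact hNp x (List.take_subset _ _ (List.take_subset _ _ hx))
        · intro h x hx z hz
          rcases List.mem_append.1 hz with hz | hz
          · exact h x hx z (by simp [hz])
          · -- otherwise `x`, the entry after the break and `z` form a 231
            obtain ⟨c, u, hc⟩ : ∃ c u, t.drop b = c :: u :=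
              ⟨t[b], t.drop (b + 1), List.drop_eq_getElem_cons (by omega)⟩
            have hxc := h x hx c (by simp [hc])
            by_contra hcon
            have hsub : [x, c, z].Sublist p := by
              rw [hpq, ← List.take_append_drop b t, hc, List.append_assoc]
              exact ((List.singleton_sublist.2 hx).append
                (((List.singleton_sublist.2 (show z ∈ u ++ y :: q by
                  rw [List.mem_append]; exact Or.inr hz)).cons_cons c)) :)
            have hne : z ≠ x := by
              rintro rfl
              rw [hpq] at hnd
              exact (List.disjoint_of_nodup_append hnd) (List.take_subset _ _ hx) hz
            exact hav x c z hsub (by omega) hxc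
      · have h3 : b = j ∨ b = j + 1 := by omega
        simp only [h3, or_true, true_iff]
        rcases h3 with rfl | rfl
        · rw [List.take_append_of_le_length (by omega), List.drop_append_of_le_length (by omega),
            List.drop_eq_nil_of_le (by omega)]
          intro x hx z hz
          simp only [List.nil_append, List.mem_singleton] at hz
          rw [hz]
          exact hNp x (List.take_subset _ _ (List.take_subset _ _ hx))
        · intro x _ z hz
          rw [List.drop_eq_nil_of_le (by simp [htl])] at hz
          simp at hz

theorem HasState.sum_le_length {w L : List ℕ} (h : HasState w L) : L.sum ≤ w.length := by
  obtain ⟨p, r, hw, hp, -⟩ := h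
  rw [hw, List.length_append]; omega

/-- The sites at which a new maximum creates no 2314 are those in the longest prefix that avoids
231. -/
theorem HasState.avoids231_take_iff {w L : List ℕ} (h : HasState w L) {j : ℕ}
    (hj : j ≤ w.length) : Avoids231 (w.take j) ↔ j ≤ L.sum := by
  obtain ⟨p, r, rfl, hp, hav, hr, -⟩ := h
  constructor
  · intro h1
    by_contra hcon
    rcases r with _ | ⟨y, r⟩
    · simp at hj; omega
    · refine hr y r rfl (h1.sublist ?_)
      rw [List.take_append, List.take_of_length_le (by omega)]
      refine (List.Sublist.refl p).append ?_
      obtain ⟨k, hk⟩ : ∃ k, j - p.length = k + 1 := ⟨j - p.length - 1, by omega⟩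
      rw [hk, List.take_succ_cons]
      exact (List.nil_sublist _).cons_cons y
  · intro h1
    rw [List.take_append_of_le_length (by omega)]
    exact hav.sublist (List.take_sublist _ _)

/-! ### Permutations avoiding 2314 and walks -/

/-- The words on `0, …, n - 1` that avoid 2314, each with its state, generated by inserting the
maximum. -/
def avoidersWithState : ℕ → List (List ℕ × List ℕ)
  | 0 => [([], [])]
  | n + 1 => (avoidersWithState n).flatMap fun q =>
      (List.range (q.2.sum + 1)).map fun j => (insertAt q.1 j n, child q.2 j)

theorem insertAt_perm (w : List ℕ) (j N : ℕ) : (insertAt w j N).Perm (N :: w) := by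
  have := List.perm_middle (a := N) (l₁ := w.take j) (l₂ := w.drop j)
  rwa [List.take_append_drop] at this

theorem insertAt_injective {v w : List ℕ} {i j N : ℕ} (hv : N ∉ v) (hw : N ∉ w)
    (hi : i ≤ v.length) (hj : j ≤ w.length) (h : insertAt v i N = insertAt w j N) :
    v = w ∧ i = j := by
  have h1 : N ∉ v.take i := fun h => hv (List.take_subset _ _ h)
  have h2 : N ∉ w.take j := fun h => hw (List.take_subset _ _ h)
  have h3 : N ∉ v.drop i := fun h => hv (List.drop_subset _ _ h)
  have h4 : N ∉ w.drop j := fun h => hw (List.drop_subset _ _ h)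
  rw [insertAt, insertAt] at h
  have e1 : v.take i = w.take j ∧ v.drop i = w.drop j := by
    have := congrArg (fun l : List ℕ => l.takeWhile (· ≠ N)) h
    have t : ∀ a b : List ℕ, N ∉ a → (a ++ N :: b).takeWhile (· ≠ N) = a := by
      intro a b ha
      rw [List.takeWhile_append_of_pos]
      · simp
      · intro x hx; simp; rintro rfl; exact ha hx
    simp only [t _ _ h1, t _ _ h2] at this
    rw [this] at h
    exact ⟨this, by simpa using h⟩
  constructor
  · rw [← List.take_append_drop i v, ← List.take_append_drop j w, e1.1, e1.2]
  · have := congrArg List.length e1.1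
    simpa [hi, hj] using this

theorem avoidersWithState_spec {n : ℕ} : ∀ q ∈ avoidersWithState n,
    q.1.Perm (List.range n) ∧ Avoids2314 q.1 ∧ HasState q.1 q.2 ∧ ∀ s ∈ q.2, 0 < s := by
  induction n with
  | zero =>
    intro q hq
    obtain rfl := List.mem_singleton.1 hq
    refine ⟨by simp, fun b c a d h => by simp at h, ⟨[], [], rfl, rfl, fun b c a h => by simp at h,
      by simp, fun b hb => ?_⟩, by simp⟩
    simp at hb
    simp [hb, IsBreak]
  | succ n ih =>
    intro q' hq'
    simp only [avoidersWithState, List.mem_flatMap, List.mem_map, List.mem_range] at hq'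
    obtain ⟨q, hq, j, hj, rfl⟩ := hq'
    obtain ⟨h1, h2, h3, h4⟩ := ih q hq
    have hlt : ∀ z ∈ q.1, z < n := fun z hz => List.mem_range.1 (h1.mem_iff.1 hz)
    have hlen := h3.sum_le_length
    refine ⟨?_, ?_, h3.insertAt_child h4 (h1.nodup_iff.2 List.nodup_range) hlt (by omega),
      child_pos h4 j⟩
    · refine (insertAt_perm _ _ _).trans ((h1.cons n).trans ?_)
      rw [List.range_succ]
      exact (List.perm_append_singleton n (List.range n)).symm
    · refine Avoids2314.insert_max (by simpa using h2) (by simpa using hlt) ?_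
      exact (h3.avoids231_take_iff (by omega)).2 (by omega)

theorem avoidersWithState_complete {n : ℕ} {w : List ℕ} (hw : w.Perm (List.range n))
    (h : Avoids2314 w) : ∃ L, (w, L) ∈ avoidersWithState n := by
  induction n generalizing w with
  | zero =>
    have : w = [] := by simpa using hw
    exact ⟨[], by simp [avoidersWithState, this]⟩
  | succ n ih =>
    obtain ⟨x, y, rfl⟩ := List.append_of_mem (hw.mem_iff.2 (List.mem_range.2 n.lt_succ_self))
    have hp : (x ++ y).Perm (List.range n) := by
      rw [List.range_succ] at hw
      exact (List.perm_middle.symm.trans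
        (hw.trans (List.perm_append_singleton n (List.range n)))).cons_inv
    have hlt : ∀ z ∈ x ++ y, z < n := fun z hz => List.mem_range.1 (hp.mem_iff.1 hz)
    have hxy : (x ++ y).Sublist (x ++ n :: y) :=
      (List.Sublist.refl x).append (List.sublist_cons_self _ _)
    obtain ⟨L, hL⟩ := ih hp (h.sublist hxy)
    obtain ⟨-, -, h3, -⟩ := avoidersWithState_spec _ hL
    have hj := (h3.avoids231_take_iff (j := x.length) (by simp)).1
      (by simpa using h.avoids231_left fun z hz => hlt z (by simp [hz]))
    refine ⟨child L x.length, ?_⟩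
    simp only [avoidersWithState, List.mem_flatMap, List.mem_map, List.mem_range]
    exact ⟨(x ++ y, L), hL, x.length, by simp; omega, by simp [insertAt]⟩

theorem avoidersWithState_nodup (n : ℕ) : ((avoidersWithState n).map Prod.fst).Nodup := by
  induction n with
  | zero => simp [avoidersWithState]
  | succ n ih =>
    have hn : ∀ q ∈ avoidersWithState n, n ∉ q.1 ∧ q.2.sum ≤ q.1.length := fun q hq => by
      obtain ⟨h1, -, h3, -⟩ := avoidersWithState_spec q hq
      exact ⟨fun h => by simpa using h1.mem_iff.1 h, h3.sum_le_length⟩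
    rw [avoidersWithState, List.map_flatMap, List.nodup_flatMap]
    constructor
    · intro q hq
      rw [List.map_map]
      refine List.Nodup.map_on ?_ List.nodup_range
      intro i hi j hj hij
      obtain ⟨h1, h2⟩ := hn q hq
      simp only [List.mem_range] at hi hj
      exact (insertAt_injective h1 h1 (by omega) (by omega) hij).2
    · rw [List.Nodup, List.pairwise_map] at ih
      refine ih.imp_of_mem fun {q q'} hq hq' hne => ?_
      intro w hw hw'
      simp only [List.map_map, List.mem_map, List.mem_range] at hw hw'
      obtain ⟨i, hi, rfl⟩ := hw
      obtain ⟨j, hj, hij⟩ := hw'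
      obtain ⟨h1, h2⟩ := hn q hq
      obtain ⟨h3, h4⟩ := hn q' hq'
      exact hne (insertAt_injective h3 h1 (by omega) (by omega) hij).1.symm

theorem sum_avoidersWithState {R : Type*} [CommRing R] (n : ℕ) (φ : List ℕ → R) :
    ((avoidersWithState n).map fun q => φ q.2).sum = walkSum n φ := by
  induction n generalizing φ with
  | zero => simp [avoidersWithState, walkSum_zero]
  | succ n ih =>
    rw [walkSum_succ, ← ih, avoidersWithState, List.map_flatMap, List.flatMap,
      List.sum_flatten, List.map_map]
    congr 1
    refine List.map_congr_left fun q _ => ?_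
    rw [Function.comp_apply, List.map_map, stepSum_apply]
    rfl

theorem contains_2314_iff {n : ℕ} (π : Equiv.Perm (Fin n)) :
    Contains ![2, 3, 1, 4] π ↔ ∃ a b c d : Fin n, a < b ∧ b < c ∧ c < d ∧
      π c < π a ∧ π a < π b ∧ π b < π d := by
  constructor
  · rintro ⟨f, hf, h⟩
    refine ⟨f 0, f 1, f 2, f 3, hf (by decide), hf (by decide), hf (by decide), ?_, ?_, ?_⟩ <;>
      rw [h] <;> decide
  · rintro ⟨a, b, c, d, hab, hbc, hcd, h1, h2, h3⟩
    refine ⟨![a, b, c, d], ?_, ?_⟩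
    · rw [Fin.strictMono_iff_lt_succ]
      intro i; fin_cases i <;> simpa
    · intro i j
      fin_cases i <;> fin_cases j <;> simp <;> order

theorem sublist_ofFn_iff {n : ℕ} (g : Fin n → ℕ) (b c a d : ℕ) :
    [b, c, a, d].Sublist (List.ofFn g) ↔ ∃ i j k l : Fin n, i < j ∧ j < k ∧ k < l ∧
      g i = b ∧ g j = c ∧ g k = a ∧ g l = d := by
  rw [List.sublist_iff_exists_fin_orderEmbedding_get_eq]
  constructor
  · rintro ⟨f, hf⟩
    have h : ∀ i, g (Fin.cast (List.length_ofFn) (f i)) = [b, c, a, d].get i := fun i => by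
      rw [hf, List.get_ofFn]
    exact ⟨_, _, _, _, f.strictMono (show (0 : Fin 4) < 1 by decide),
      f.strictMono (show (1 : Fin 4) < 2 by decide), f.strictMono (show (2 : Fin 4) < 3 by decide),
      h 0, h 1, h 2, h 3⟩
  · rintro ⟨i, j, k, l, hij, hjk, hkl, rfl, rfl, rfl, rfl⟩
    have hm : StrictMono (![i, j, k, l] : Fin 4 → Fin n) := by
      rw [Fin.strictMono_iff_lt_succ]
      intro i; fin_cases i <;> simpa
    refine ⟨OrderEmbedding.ofStrictMono
      (fun x : Fin 4 => Fin.cast (List.length_ofFn).symm (![i, j, k, l] x)) fun x y h => hm h, ?_⟩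
    intro x
    change Fin 4 at x
    fin_cases x <;> rw [List.get_ofFn] <;> rfl

theorem avoids_2314_iff {n : ℕ} (π : Equiv.Perm (Fin n)) :
    Avoids ![2, 3, 1, 4] π ↔ Avoids2314 (List.ofFn fun i => (π i : ℕ)) := by
  rw [Avoids, contains_2314_iff]
  constructor
  · intro h b c a d hs h1 h2 h3
    obtain ⟨i, j, k, l, hij, hjk, hkl, rfl, rfl, rfl, rfl⟩ := (sublist_ofFn_iff _ _ _ _ _).1 hs
    exact h ⟨i, j, k, l, hij, hjk, hkl, h1, h2, h3⟩
  · rintro h ⟨i, j, k, l, hij, hjk, hkl, h1, h2, h3⟩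
    exact h _ _ _ _ ((sublist_ofFn_iff _ _ _ _ _).2
      ⟨i, j, k, l, hij, hjk, hkl, rfl, rfl, rfl, rfl⟩) h1 h2 h3

/-- The permutations avoiding 2314 correspond to walks on states. -/
theorem avoidCount_2314 (n : ℕ) :
    (avoidCount ![2, 3, 1, 4] n : ℚ) = walkSum n fun _ => (1 : ℚ) := by
  let e : Equiv.Perm (Fin n) → List ℕ := fun π => List.ofFn fun i => (π i : ℕ)
  have he : Function.Injective e := by
    intro π ρ h
    ext i
    exact congrFun (List.ofFn_injective h) i
  have him : e '' {π | Avoids ![2, 3, 1, 4] π}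
      = ((((avoidersWithState n).map Prod.fst).toFinset : Finset (List ℕ)) : Set (List ℕ)) := by
    ext w
    simp only [Set.mem_image, Set.mem_ofPred_eq, List.coe_toFinset, List.mem_map, Prod.exists,
      exists_and_right, exists_eq_right]
    constructor
    · rintro ⟨π, hπ, rfl⟩
      refine avoidersWithState_complete ?_ ((avoids_2314_iff π).1 hπ)
      refine (List.perm_ext_iff_of_nodup ?_ List.nodup_range).2 fun x => ?_
      · exact List.nodup_ofFn.2 (Fin.val_injective.comp π.injective)
      · simp only [e, List.mem_ofFn, List.mem_range]
        constructor
        · rintro ⟨i, rfl⟩; exact (π i).2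
        · intro hx; exact ⟨π.symm ⟨x, hx⟩, by simp⟩
    · rintro ⟨L, hL⟩
      obtain ⟨h1, h2, -, -⟩ := avoidersWithState_spec _ hL
      simp only at h1 h2
      have hlen : w.length = n := by simpa using h1.length_eq
      subst hlen
      have hlt : ∀ i : Fin w.length, w[i] < w.length := fun i =>
        List.mem_range.1 (h1.mem_iff.1 (List.getElem_mem _))
      let f : Fin w.length → Fin w.length := fun i => ⟨w[i], hlt i⟩
      have hf : Function.Injective f := by
        intro i j hij
        have hnd : w.Nodup := h1.nodup_iff.2 List.nodup_range
        exact Fin.ext ((List.Nodup.getElem_inj_iff hnd).1 (Fin.mk.inj_iff.1 hij))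
      have hw : e (Equiv.ofBijective f (Finite.injective_iff_bijective.1 hf)) = w := by
        simp only [e, Equiv.ofBijective_apply, f]
        exact List.ofFn_getElem
      refine ⟨_, (avoids_2314_iff _).2 ?_, hw⟩
      have : (List.ofFn fun i =>
        ((Equiv.ofBijective f (Finite.injective_iff_bijective.1 hf)) i : ℕ)) = w := hw
      rwa [this]
  rw [avoidCount, ← Set.ncard_image_of_injective _ he, him, Set.ncard_coe_finset,
    List.toFinset_card_of_nodup (avoidersWithState_nodup n), List.length_map,
    ← sum_avoidersWithState]
  simp

theorem avoidGF_2314 : avoidGF ![2, 3, 1, 4] = evalOne walkGF := by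
  ext n
  rw [avoidGF, PowerSeries.coeff_mk, avoidCount_2314, evalOne, PowerSeries.coeff_map, walkGF,
    PowerSeries.coeff_mk, map_walkSum]
  simp

/-! ### Direct sums and descents -/

/-- The direct sum `α ⊕ β` of two permutations. -/
def directSum {j m : ℕ} (α : Equiv.Perm (Fin j)) (β : Equiv.Perm (Fin m)) :
    Equiv.Perm (Fin (j + m)) :=
  finSumFinEquiv.permCongr (Equiv.sumCongr α β)

@[simp]
theorem directSum_castAdd {j m : ℕ} (α : Equiv.Perm (Fin j)) (β : Equiv.Perm (Fin m))
    (i : Fin j) : directSum α β (Fin.castAdd m i) = Fin.castAdd m (α i) := by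
  simp [directSum, Equiv.permCongr_apply]

@[simp]
theorem directSum_natAdd {j m : ℕ} (α : Equiv.Perm (Fin j)) (β : Equiv.Perm (Fin m))
    (i : Fin m) : directSum α β (Fin.natAdd j i) = Fin.natAdd j (β i) := by
  simp [directSum, Equiv.permCongr_apply]

/-- The first `j` entries of `π` form a permutation of the first `j` values. -/
def Splits {n : ℕ} (π : Equiv.Perm (Fin n)) (j : ℕ) : Prop :=
  ∀ i : Fin n, (i : ℕ) < j → (π i : ℕ) < j

theorem image_eq_iff_splits {n : ℕ} (π : Equiv.Perm (Fin n)) (j : ℕ) :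
    π '' {i : Fin n | (i : ℕ) < j} = {i : Fin n | (i : ℕ) < j} ↔ Splits π j := by
  constructor
  · intro h i hi
    have : π i ∈ π '' {i : Fin n | (i : ℕ) < j} := ⟨i, hi, rfl⟩
    rw [h] at this
    exact this
  · intro h
    refine Set.eq_of_subset_of_ncard_le ?_ ?_ (Set.toFinite _)
    · rintro _ ⟨i, hi, rfl⟩
      exact h i hi
    · rw [Set.ncard_image_of_injective _ π.injective]

theorem Splits.le_apply {n : ℕ} {π : Equiv.Perm (Fin n)} {j : ℕ} (h : Splits π j) {i : Fin n}
    (hi : j ≤ (i : ℕ)) : j ≤ (π i : ℕ) := by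
  by_contra hlt
  have h1 : π i ∈ π '' {i : Fin n | (i : ℕ) < j} := by
    rw [(image_eq_iff_splits π j).2 h]
    exact not_le.1 hlt
  obtain ⟨i', hi', he⟩ := h1
  rw [π.injective he] at hi'
  exact absurd hi' (not_lt.2 hi)

theorem indecomposable_iff {n : ℕ} (π : Equiv.Perm (Fin n)) :
    Indecomposable π ↔ 0 < n ∧ ∀ j, 0 < j → j < n → ¬ Splits π j := by
  simp only [Indecomposable, ne_eq, image_eq_iff_splits]

theorem splits_self {n : ℕ} (π : Equiv.Perm (Fin n)) : Splits π n := fun i _ => (π i).2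

theorem splits_directSum_iff {j m k : ℕ} (α : Equiv.Perm (Fin j)) (β : Equiv.Perm (Fin m))
    (hk : k ≤ j) : Splits (directSum α β) k ↔ Splits α k := by
  constructor
  · intro h i hi
    simpa using h (Fin.castAdd m i) (by simpa using hi)
  · intro h i
    refine Fin.addCases (fun i hi => ?_) (fun i hi => ?_) i
    · simpa using h i (by simpa using hi)
    · simp at hi; omega

theorem exists_directSum_of_splits {j m : ℕ} {π : Equiv.Perm (Fin (j + m))} (h : Splits π j) :
    ∃ α β, directSum (j := j) (m := m) α β = π := by
  obtain ⟨⟨α, β⟩, hαβ⟩ := Equiv.Perm.mem_sumCongrHom_range_of_perm_mapsTo_inl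
    (σ := finSumFinEquiv.symm.permCongr π) (by
      rintro _ ⟨i, rfl⟩
      have h1 := h (Fin.castAdd m i) (by simp)
      rw [Equiv.permCongr_apply]
      refine ⟨⟨π (Fin.castAdd m i), h1⟩, ?_⟩
      rw [Equiv.eq_symm_apply]
      ext
      simp)
  refine ⟨α, β, ?_⟩
  have h2 : Equiv.sumCongr α β = finSumFinEquiv.symm.permCongr π := hαβ
  rw [directSum, h2]
  ext
  simp [Equiv.permCongr_apply]

theorem directSum_injective {j m : ℕ} :
    Function.Injective fun p : Equiv.Perm (Fin j) × Equiv.Perm (Fin m) => directSum p.1 p.2 := by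
  rintro ⟨α, β⟩ ⟨α', β'⟩ h
  simp only at h
  have h1 : α = α' := by
    ext i
    simpa using congrArg (fun π => (π (Fin.castAdd m i) : ℕ)) h
  have h2 : β = β' := by
    ext i
    simpa using congrArg (fun π => (π (Fin.natAdd j i) : ℕ)) h
  rw [h1, h2]

theorem des_directSum {j m : ℕ} (α : Equiv.Perm (Fin j)) (β : Equiv.Perm (Fin m)) :
    des (directSum α β) = des α + des β := by
  have h : {i : Fin (j + m) | ∃ h : (i : ℕ) + 1 < j + m,
        directSum α β ⟨(i : ℕ) + 1, h⟩ < directSum α β i}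
      = Fin.castAdd m '' {i : Fin j | ∃ h : (i : ℕ) + 1 < j, α ⟨(i : ℕ) + 1, h⟩ < α i}
        ∪ Fin.natAdd j '' {i : Fin m | ∃ h : (i : ℕ) + 1 < m, β ⟨(i : ℕ) + 1, h⟩ < β i} := by
    ext i
    refine Fin.addCases (fun i => ?_) (fun i => ?_) i
    · simp only [Set.mem_ofPred_eq, Set.mem_union, Set.mem_image, directSum_castAdd,
        Fin.val_castAdd]
      constructor
      · rintro ⟨h, hlt⟩
        by_cases h1 : (i : ℕ) + 1 < j
        · have e : (⟨(i : ℕ) + 1, h⟩ : Fin (j + m)) = Fin.castAdd m ⟨(i : ℕ) + 1, h1⟩ := rfl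
          rw [e, directSum_castAdd] at hlt
          exact Or.inl ⟨i, ⟨h1, hlt⟩, rfl⟩
        · have h2 : (i : ℕ) + 1 = j := by omega
          have e : (⟨(i : ℕ) + 1, h⟩ : Fin (j + m)) = Fin.natAdd j ⟨0, by omega⟩ :=
            Fin.ext (by simp [h2])
          rw [e, directSum_natAdd, Fin.lt_def] at hlt
          simp at hlt
          omega
      · rintro (⟨i', ⟨h1, hlt⟩, he⟩ | ⟨i', -, he⟩)
        · obtain rfl := Fin.castAdd_injective _ _ he
          refine ⟨by omega, ?_⟩
          have e : (⟨(i' : ℕ) + 1, by omega⟩ : Fin (j + m))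
              = Fin.castAdd m ⟨(i' : ℕ) + 1, h1⟩ := rfl
          rw [e, directSum_castAdd]
          exact hlt
        · have := congrArg Fin.val he
          simp at this; omega
    · simp only [Set.mem_ofPred_eq, Set.mem_union, Set.mem_image, directSum_natAdd,
        Fin.val_natAdd]
      constructor
      · rintro ⟨h, hlt⟩
        have h1 : (i : ℕ) + 1 < m := by omega
        have e : (⟨j + (i : ℕ) + 1, h⟩ : Fin (j + m)) = Fin.natAdd j ⟨(i : ℕ) + 1, h1⟩ :=
          Fin.ext (by simp [add_assoc])
        rw [e, directSum_natAdd] at hlt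
        exact Or.inr ⟨i, ⟨h1, by simpa using hlt⟩, rfl⟩
      · rintro (⟨i', -, he⟩ | ⟨i', ⟨h1, hlt⟩, he⟩)
        · have := congrArg Fin.val he
          simp at this; omega
        · obtain rfl := Fin.natAdd_injective _ _ he
          refine ⟨by omega, ?_⟩
          have e : (⟨j + (i' : ℕ) + 1, by omega⟩ : Fin (j + m))
              = Fin.natAdd j ⟨(i' : ℕ) + 1, h1⟩ := Fin.ext (by simp [add_assoc])
          rw [e, directSum_natAdd]
          simpa using hlt
  rw [des, h, Set.ncard_union_eq ?_ (Set.toFinite _) (Set.toFinite _),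
    Set.ncard_image_of_injective _ (Fin.castAdd_injective _ _),
    Set.ncard_image_of_injective _ (Fin.natAdd_injective _ _), des, des]
  rw [Set.disjoint_left]
  rintro _ ⟨i, -, rfl⟩ ⟨i', -, he⟩
  have := congrArg Fin.val he
  simp at this; omega

/-- The size of the first sum-indecomposable component of a nonempty permutation. -/
noncomputable def firstSplit {n : ℕ} (π : Equiv.Perm (Fin n)) : ℕ := sInf {j | 0 < j ∧ Splits π j}

theorem firstSplit_eq_iff {n : ℕ} (hn : 0 < n) (π : Equiv.Perm (Fin n)) (j : ℕ) :
    firstSplit π = j ↔ 0 < j ∧ Splits π j ∧ ∀ k, 0 < k → k < j → ¬ Splits π k := by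
  have hmem : firstSplit π ∈ {j | 0 < j ∧ Splits π j} := Nat.sInf_mem ⟨n, hn, splits_self π⟩
  have hmin : ∀ k, 0 < k → Splits π k → firstSplit π ≤ k := fun k h1 h2 => Nat.sInf_le ⟨h1, h2⟩
  constructor
  · rintro rfl
    exact ⟨hmem.1, hmem.2, fun k h1 h2 h3 => absurd (hmin k h1 h3) (not_le.2 h2)⟩
  · rintro ⟨h1, h2, h3⟩
    refine le_antisymm (hmin j h1 h2) ?_
    by_contra hlt
    exact h3 _ hmem.1 (not_le.1 hlt) hmem.2

open Classical in
/-- The descent polynomial of the permutations of `Fin n` that satisfy `P`. -/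
noncomputable def desSum {n : ℕ} (P : Equiv.Perm (Fin n) → Prop) : ℤ[X] :=
  ∑ π with P π, Polynomial.X ^ des π

theorem desSum_congr {n : ℕ} {P Q : Equiv.Perm (Fin n) → Prop} (h : ∀ π, P π ↔ Q π) :
    desSum P = desSum Q := by
  rw [show P = Q from funext fun π => propext (h π)]

theorem desSum_eq_zero {n : ℕ} {P : Equiv.Perm (Fin n) → Prop} (h : ∀ π, ¬ P π) :
    desSum P = 0 := by
  simp [desSum, h]

theorem desSum_firstSplit {P R : ∀ n, Equiv.Perm (Fin n) → Prop}
    (hPR : ∀ j m, 0 < j → 0 < m → ∀ (α : Equiv.Perm (Fin j)) (β : Equiv.Perm (Fin m)),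
      P (j + m) (directSum α β) ↔ R j α ∧ P m β) {j m : ℕ} (hm : 0 < m) :
    desSum (fun π => P (j + m) π ∧ firstSplit π = j)
      = desSum (fun π => R j π ∧ Indecomposable π) * desSum (P m) := by
  classical
  rw [desSum, desSum, desSum, Finset.sum_mul_sum, ← Finset.sum_product']
  symm
  refine Finset.sum_nbij (fun p => directSum p.1 p.2) ?_ directSum_injective.injOn ?_ ?_
  · rintro ⟨α, β⟩ h
    simp only [Finset.mem_product, Finset.mem_filter, Finset.mem_univ, true_and] at h ⊢
    obtain ⟨⟨h1, h2⟩, h3⟩ := h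
    rw [indecomposable_iff] at h2
    refine ⟨(hPR j m h2.1 hm α β).2 ⟨h1, h3⟩, (firstSplit_eq_iff (by omega) _ _).2
      ⟨h2.1, (splits_directSum_iff α β le_rfl).2 (splits_self α), fun k hk hkj => ?_⟩⟩
    rw [splits_directSum_iff α β hkj.le]
    exact h2.2 k hk hkj
  · intro π h
    simp only [Finset.coe_filter, Finset.mem_univ, true_and, Set.mem_ofPred_eq] at h
    obtain ⟨h1, h2⟩ := h
    obtain ⟨hj, hs, hmin⟩ := (firstSplit_eq_iff (by omega) _ _).1 h2
    obtain ⟨α, β, rfl⟩ := exists_directSum_of_splits hs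
    obtain ⟨hα, hβ⟩ := (hPR j m hj hm α β).1 h1
    refine ⟨(α, β), ?_, rfl⟩
    simp only [Finset.coe_product, Set.mem_prod, Finset.coe_filter, Finset.mem_univ, true_and,
      Set.mem_ofPred_eq]
    refine ⟨⟨hα, (indecomposable_iff α).2 ⟨hj, fun k hk hkj => ?_⟩⟩, hβ⟩
    rw [← splits_directSum_iff α β hkj.le]
    exact hmin k hk hkj
  · rintro ⟨α, β⟩ -
    rw [des_directSum, pow_add]

theorem firstSplit_eq_self_iff {n : ℕ} (π : Equiv.Perm (Fin n)) (hn : 0 < n) :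
    firstSplit π = n ↔ Indecomposable π := by
  rw [firstSplit_eq_iff hn, indecomposable_iff]
  simp [splits_self]

theorem desSum_eq_sum_antidiagonal {P R : ∀ n, Equiv.Perm (Fin n) → Prop}
    (hPR : ∀ j m, 0 < j → 0 < m → ∀ (α : Equiv.Perm (Fin j)) (β : Equiv.Perm (Fin m)),
      P (j + m) (directSum α β) ↔ R j α ∧ P m β) {n : ℕ} (hn : 0 < n) :
    desSum (P n) = desSum (fun π => P n π ∧ Indecomposable π)
      + ∑ p ∈ Finset.HasAntidiagonal.antidiagonal n,
        desSum (fun π => R p.1 π ∧ Indecomposable π) * if p.2 = 0 then 0 else desSum (P p.2) := by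
  classical
  obtain ⟨n, rfl⟩ : ∃ k, n = k + 1 := ⟨n - 1, by omega⟩
  have h1 : desSum (P (n + 1)) = ∑ p ∈ Finset.HasAntidiagonal.antidiagonal (n + 1),
      desSum fun π => P (n + 1) π ∧ firstSplit π = p.1 := by
    rw [desSum, Finset.Nat.sum_antidiagonal_eq_sum_range_succ_mk,
      ← Finset.sum_fiberwise_of_maps_to (g := firstSplit) (t := Finset.range (n + 1).succ)]
    · refine Finset.sum_congr rfl fun j _ => ?_
      rw [desSum]
      exact Finset.sum_congr (by ext; simp) fun _ _ => rfl
    · intro π _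
      rw [Finset.mem_range, Nat.lt_succ_iff]
      exact Nat.sInf_le ⟨hn, splits_self π⟩
  rw [h1, Finset.Nat.sum_antidiagonal_succ', Finset.Nat.sum_antidiagonal_succ']
  simp only [if_true, mul_zero, zero_add]
  congr 1
  · exact desSum_congr fun π => and_congr_right fun _ => firstSplit_eq_self_iff π hn
  · refine Finset.sum_congr rfl fun p hp => ?_
    rw [if_neg (by omega), ← desSum_firstSplit hPR (by omega)]
    have : n + 1 = p.1 + (p.2 + 1) := by
      rw [← add_assoc, Finset.HasAntidiagonal.mem_antidiagonal.1 hp]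
    rw [this]

theorem sum_monomial_eq_desSum {n : ℕ} (P : Equiv.Perm (Fin n) → Prop) :
    ∑ i ∈ Finset.range (n + 1), Polynomial.monomial i (Set.ncard {π | P π ∧ des π = i} : ℤ)
      = desSum P := by
  classical
  have hdes : ∀ π : Equiv.Perm (Fin n), des π ≤ n := fun π => by
    have := Set.ncard_le_ncard (Set.subset_univ
      {i : Fin n | ∃ h : (i : ℕ) + 1 < n, π ⟨(i : ℕ) + 1, h⟩ < π i})
    simpa [des, Set.ncard_univ] using this
  rw [desSum, ← Finset.sum_fiberwise_of_maps_to (g := des) (t := Finset.range (n + 1))]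
  · refine Finset.sum_congr rfl fun i _ => ?_
    have h1 : {π | P π ∧ des π = i}
        = ((Finset.univ.filter fun π => P π).filter fun π => des π = i :
          Set (Equiv.Perm (Fin n))) := by
      ext; simp
    rw [h1, Set.ncard_coe_finset, Finset.sum_congr rfl (g := fun _ => Polynomial.X ^ i)]
    · rw [Finset.sum_const, nsmul_eq_mul, ← Polynomial.C_mul_X_pow_eq_monomial]
      simp
    · intro π hπ
      rw [(Finset.mem_filter.1 hπ).2]
  · intro π _
    rw [Finset.mem_range, Nat.lt_succ_iff]
    exact hdes π

theorem coeff_avoidGF₂ {k : ℕ} (σ : Fin k → ℕ) (n : ℕ) :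
    PowerSeries.coeff n (avoidGF₂ σ) = desSum fun π : Equiv.Perm (Fin n) => Avoids σ π := by
  rw [avoidGF₂, PowerSeries.coeff_mk, ← sum_monomial_eq_desSum]
  rfl

theorem coeff_indecGF₂ {k : ℕ} (σ : Fin k → ℕ) (n : ℕ) :
    PowerSeries.coeff n (indecGF₂ σ)
      = desSum fun π : Equiv.Perm (Fin n) => Avoids σ π ∧ Indecomposable π := by
  rw [indecGF₂, PowerSeries.coeff_mk, ← sum_monomial_eq_desSum]
  simp only [and_assoc]
  rfl

theorem avoids_zero {k : ℕ} (hk : 0 < k) (σ : Fin k → ℕ) (π : Equiv.Perm (Fin 0)) : Avoids σ π :=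
  fun ⟨f, _⟩ => (f ⟨0, hk⟩).elim0

/-- Splitting off the first component of a decomposable permutation. There is no descent between the
summands of a direct sum, so the descent numbers add. -/
theorem avoidGF₂_eq {k l : ℕ} (hk : 0 < k) {σ : Fin k → ℕ} {ρ : Fin l → ℕ}
    (h : ∀ j m, 0 < j → 0 < m → ∀ (α : Equiv.Perm (Fin j)) (β : Equiv.Perm (Fin m)),
      Avoids σ (directSum α β) ↔ Avoids ρ α ∧ Avoids σ β) :
    avoidGF₂ σ = 1 + indecGF₂ σ + indecGF₂ ρ * (avoidGF₂ σ - 1) := by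
  have h0 : PowerSeries.coeff 0 (avoidGF₂ σ) = 1 := by
    classical
    rw [coeff_avoidGF₂, desSum, Finset.filter_true_of_mem fun π _ => avoids_zero hk σ π]
    simp [des]
  have hi0 : ∀ (i : ℕ) (τ : Fin i → ℕ), PowerSeries.coeff 0 (indecGF₂ τ) = 0 := fun i τ => by
    rw [coeff_indecGF₂]
    exact desSum_eq_zero fun π h => absurd h.2.1 (lt_irrefl 0)
  ext1 n
  rcases Nat.eq_zero_or_pos n with rfl | hn
  · rw [map_add, map_add, PowerSeries.coeff_mul]
    rw [h0, hi0]
    simp [hi0, -PowerSeries.coeff_zero_eq_constantCoeff]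
  · rw [map_add, map_add, PowerSeries.coeff_mul, coeff_avoidGF₂, coeff_indecGF₂,
      desSum_eq_sum_antidiagonal (P := fun _ π => Avoids σ π) (R := fun _ π => Avoids ρ π) h hn,
      PowerSeries.coeff_one, if_neg hn.ne', zero_add]
    congr 1
    refine Finset.sum_congr rfl fun p _ => ?_
    rw [coeff_indecGF₂, map_sub, PowerSeries.coeff_one]
    congr 1
    split_ifs with hp
    · rw [hp, h0, sub_self]
    · rw [coeff_avoidGF₂, sub_zero]

/-! ### The patterns and direct sums -/

theorem contains_3124_iff {n : ℕ} (π : Equiv.Perm (Fin n)) :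
    Contains ![3, 1, 2, 4] π ↔ ∃ a b c d : Fin n, a < b ∧ b < c ∧ c < d ∧
      π b < π c ∧ π c < π a ∧ π a < π d := by
  constructor
  · rintro ⟨f, hf, h⟩
    refine ⟨f 0, f 1, f 2, f 3, hf (by decide), hf (by decide), hf (by decide), ?_, ?_, ?_⟩ <;>
      rw [h] <;> decide
  · rintro ⟨a, b, c, d, hab, hbc, hcd, h1, h2, h3⟩
    refine ⟨![a, b, c, d], ?_, ?_⟩
    · rw [Fin.strictMono_iff_lt_succ]
      intro i; fin_cases i <;> simpa
    · intro i j
      fin_cases i <;> fin_cases j <;> simp <;> order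

theorem contains_1342_iff {n : ℕ} (π : Equiv.Perm (Fin n)) :
    Contains ![1, 3, 4, 2] π ↔ ∃ a b c d : Fin n, a < b ∧ b < c ∧ c < d ∧
      π a < π d ∧ π d < π b ∧ π b < π c := by
  constructor
  · rintro ⟨f, hf, h⟩
    refine ⟨f 0, f 1, f 2, f 3, hf (by decide), hf (by decide), hf (by decide), ?_, ?_, ?_⟩ <;>
      rw [h] <;> decide
  · rintro ⟨a, b, c, d, hab, hbc, hcd, h1, h2, h3⟩
    refine ⟨![a, b, c, d], ?_, ?_⟩
    · rw [Fin.strictMono_iff_lt_succ]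
      intro i; fin_cases i <;> simpa
    · intro i j
      fin_cases i <;> fin_cases j <;> simp <;> order

theorem contains_231_iff {n : ℕ} (π : Equiv.Perm (Fin n)) :
    Contains ![2, 3, 1] π ↔ ∃ a b c : Fin n, a < b ∧ b < c ∧ π c < π a ∧ π a < π b := by
  constructor
  · rintro ⟨f, hf, h⟩
    refine ⟨f 0, f 1, f 2, hf (by decide), hf (by decide), ?_, ?_⟩ <;> rw [h] <;> decide
  · rintro ⟨a, b, c, hab, hbc, h1, h2⟩
    refine ⟨![a, b, c], ?_, ?_⟩
    · rw [Fin.strictMono_iff_lt_succ]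
      intro i; fin_cases i <;> simpa
    · intro i j
      fin_cases i <;> fin_cases j <;> simp <;> order

theorem contains_312_iff {n : ℕ} (π : Equiv.Perm (Fin n)) :
    Contains ![3, 1, 2] π ↔ ∃ a b c : Fin n, a < b ∧ b < c ∧ π b < π c ∧ π c < π a := by
  constructor
  · rintro ⟨f, hf, h⟩
    refine ⟨f 0, f 1, f 2, hf (by decide), hf (by decide), ?_, ?_⟩ <;> rw [h] <;> decide
  · rintro ⟨a, b, c, hab, hbc, h1, h2⟩
    refine ⟨![a, b, c], ?_, ?_⟩
    · rw [Fin.strictMono_iff_lt_succ]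
      intro i; fin_cases i <;> simpa
    · intro i j
      fin_cases i <;> fin_cases j <;> simp <;> order

theorem exists_castAdd {j m : ℕ} (i : Fin (j + m)) (h : (i : ℕ) < j) :
    ∃ k : Fin j, Fin.castAdd m k = i := ⟨⟨i, h⟩, rfl⟩

theorem exists_natAdd {j m : ℕ} (i : Fin (j + m)) (h : j ≤ (i : ℕ)) :
    ∃ k : Fin m, Fin.natAdd j k = i := ⟨⟨i - j, by omega⟩, Fin.ext (by simp; omega)⟩

theorem splits_directSum {j m : ℕ} (α : Equiv.Perm (Fin j)) (β : Equiv.Perm (Fin m)) :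
    Splits (directSum α β) j :=
  (splits_directSum_iff α β le_rfl).2 (splits_self α)

/-- In a direct sum, an entry that is followed by a smaller entry of the upper summand lies in the
upper summand. -/
theorem le_of_directSum_lt {j m : ℕ} {α : Equiv.Perm (Fin j)} {β : Equiv.Perm (Fin m)}
    {a c : Fin (j + m)} (hc : j ≤ (c : ℕ)) (h : directSum α β c < directSum α β a) :
    j ≤ (a : ℕ) := by
  by_contra ha
  have h1 := splits_directSum α β a (not_le.1 ha)
  have h2 := (splits_directSum α β).le_apply hc
  rw [Fin.lt_def] at h
  omega

theorem avoids_231_directSum {j m : ℕ} (α : Equiv.Perm (Fin j)) (β : Equiv.Perm (Fin m)) :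
    Avoids ![2, 3, 1] (directSum α β) ↔ Avoids ![2, 3, 1] α ∧ Avoids ![2, 3, 1] β := by
  simp only [Avoids, ← not_or, contains_231_iff]
  refine not_congr ⟨?_, ?_⟩
  · rintro ⟨a, b, c, hab, hbc, h1, h2⟩
    rw [Fin.lt_def] at hab hbc
    rcases Nat.lt_or_ge c j with hc | hc
    · obtain ⟨a, rfl⟩ := exists_castAdd a (by omega)
      obtain ⟨b, rfl⟩ := exists_castAdd b (by omega)
      obtain ⟨c, rfl⟩ := exists_castAdd c (by omega)
      simp only [directSum_castAdd, Fin.lt_def, Fin.val_castAdd] at h1 h2 hab hbc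
      exact Or.inl ⟨a, b, c, hab, hbc, h1, h2⟩
    · have ha := le_of_directSum_lt hc h1
      obtain ⟨a, rfl⟩ := exists_natAdd a (by omega)
      obtain ⟨b, rfl⟩ := exists_natAdd b (by omega)
      obtain ⟨c, rfl⟩ := exists_natAdd c (by omega)
      simp only [directSum_natAdd, Fin.lt_def, Fin.val_natAdd, add_lt_add_iff_left]
        at h1 h2 hab hbc
      exact Or.inr ⟨a, b, c, hab, hbc, h1, h2⟩
  · rintro (⟨a, b, c, hab, hbc, h1, h2⟩ | ⟨a, b, c, hab, hbc, h1, h2⟩)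
    · refine ⟨Fin.castAdd m a, Fin.castAdd m b, Fin.castAdd m c, ?_⟩
      simp only [directSum_castAdd, Fin.lt_def, Fin.val_castAdd]
      exact ⟨hab, hbc, h1, h2⟩
    · refine ⟨Fin.natAdd j a, Fin.natAdd j b, Fin.natAdd j c, ?_⟩
      simp only [directSum_natAdd, Fin.lt_def, Fin.val_natAdd, add_lt_add_iff_left]
      exact ⟨hab, hbc, h1, h2⟩

theorem avoids_2314_directSum {j m : ℕ} (hm : 0 < m) (α : Equiv.Perm (Fin j))
    (β : Equiv.Perm (Fin m)) :
    Avoids ![2, 3, 1, 4] (directSum α β) ↔ Avoids ![2, 3, 1] α ∧ Avoids ![2, 3, 1, 4] β := by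
  simp only [Avoids, ← not_or, contains_231_iff, contains_2314_iff]
  refine not_congr ⟨?_, ?_⟩
  · rintro ⟨a, b, c, d, hab, hbc, hcd, h1, h2, h3⟩
    rw [Fin.lt_def] at hab hbc hcd
    rcases Nat.lt_or_ge c j with hc | hc
    · obtain ⟨a, rfl⟩ := exists_castAdd a (by omega)
      obtain ⟨b, rfl⟩ := exists_castAdd b (by omega)
      obtain ⟨c, rfl⟩ := exists_castAdd c (by omega)
      simp only [directSum_castAdd, Fin.lt_def, Fin.val_castAdd] at h1 h2 hab hbc
      exact Or.inl ⟨a, b, c, hab, hbc, h1, h2⟩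
    · have ha := le_of_directSum_lt hc h1
      obtain ⟨a, rfl⟩ := exists_natAdd a (by omega)
      obtain ⟨b, rfl⟩ := exists_natAdd b (by omega)
      obtain ⟨c, rfl⟩ := exists_natAdd c (by omega)
      obtain ⟨d, rfl⟩ := exists_natAdd d (by omega)
      simp only [directSum_natAdd, Fin.lt_def, Fin.val_natAdd, add_lt_add_iff_left]
        at h1 h2 h3 hab hbc hcd
      exact Or.inr ⟨a, b, c, d, hab, hbc, hcd, h1, h2, h3⟩
  · rintro (⟨a, b, c, hab, hbc, h1, h2⟩ | ⟨a, b, c, d, hab, hbc, hcd, h1, h2, h3⟩)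
    · refine ⟨Fin.castAdd m a, Fin.castAdd m b, Fin.castAdd m c, Fin.natAdd j ⟨0, hm⟩, ?_⟩
      simp only [directSum_castAdd, directSum_natAdd, Fin.lt_def, Fin.val_castAdd, Fin.val_natAdd]
      rw [Fin.lt_def] at *
      omega
    · refine ⟨Fin.natAdd j a, Fin.natAdd j b, Fin.natAdd j c, Fin.natAdd j d, ?_⟩
      simp only [directSum_natAdd, Fin.lt_def, Fin.val_natAdd, add_lt_add_iff_left]
      exact ⟨hab, hbc, hcd, h1, h2, h3⟩

theorem avoids_3124_directSum {j m : ℕ} (hm : 0 < m) (α : Equiv.Perm (Fin j))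
    (β : Equiv.Perm (Fin m)) :
    Avoids ![3, 1, 2, 4] (directSum α β) ↔ Avoids ![3, 1, 2] α ∧ Avoids ![3, 1, 2, 4] β := by
  simp only [Avoids, ← not_or, contains_312_iff, contains_3124_iff]
  refine not_congr ⟨?_, ?_⟩
  · rintro ⟨a, b, c, d, hab, hbc, hcd, h1, h2, h3⟩
    rw [Fin.lt_def] at hab hbc hcd
    rcases Nat.lt_or_ge c j with hc | hc
    · obtain ⟨a, rfl⟩ := exists_castAdd a (by omega)
      obtain ⟨b, rfl⟩ := exists_castAdd b (by omega)
      obtain ⟨c, rfl⟩ := exists_castAdd c (by omega)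
      simp only [directSum_castAdd, Fin.lt_def, Fin.val_castAdd] at h1 h2 hab hbc
      exact Or.inl ⟨a, b, c, hab, hbc, h1, h2⟩
    · have ha := le_of_directSum_lt hc h2
      obtain ⟨a, rfl⟩ := exists_natAdd a (by omega)
      obtain ⟨b, rfl⟩ := exists_natAdd b (by omega)
      obtain ⟨c, rfl⟩ := exists_natAdd c (by omega)
      obtain ⟨d, rfl⟩ := exists_natAdd d (by omega)
      simp only [directSum_natAdd, Fin.lt_def, Fin.val_natAdd, add_lt_add_iff_left]
        at h1 h2 h3 hab hbc hcd
      exact Or.inr ⟨a, b, c, d, hab, hbc, hcd, h1, h2, h3⟩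
  · rintro (⟨a, b, c, hab, hbc, h1, h2⟩ | ⟨a, b, c, d, hab, hbc, hcd, h1, h2, h3⟩)
    · refine ⟨Fin.castAdd m a, Fin.castAdd m b, Fin.castAdd m c, Fin.natAdd j ⟨0, hm⟩, ?_⟩
      simp only [directSum_castAdd, directSum_natAdd, Fin.lt_def, Fin.val_castAdd, Fin.val_natAdd]
      rw [Fin.lt_def] at *
      omega
    · refine ⟨Fin.natAdd j a, Fin.natAdd j b, Fin.natAdd j c, Fin.natAdd j d, ?_⟩
      simp only [directSum_natAdd, Fin.lt_def, Fin.val_natAdd, add_lt_add_iff_left]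
      exact ⟨hab, hbc, hcd, h1, h2, h3⟩

/-! ### Inverse and reverse-complement -/

theorem ncard_preimage_equiv {α β : Type*} (e : α ≃ β) (P : β → Prop) :
    Set.ncard {a | P (e a)} = Set.ncard {b | P b} := by
  rw [← Set.ncard_image_of_injective _ e.injective]
  congr 1
  ext b
  constructor
  · rintro ⟨a, ha, rfl⟩; exact ha
  · intro hb; exact ⟨e.symm b, by simpa using hb, by simp⟩

theorem avoids_2314_inv {n : ℕ} (π : Equiv.Perm (Fin n)) :
    Avoids ![2, 3, 1, 4] π⁻¹ ↔ Avoids ![3, 1, 2, 4] π := by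
  simp only [Avoids, contains_2314_iff, contains_3124_iff]
  refine not_congr ⟨?_, ?_⟩
  · rintro ⟨a, b, c, d, hab, hbc, hcd, h1, h2, h3⟩
    exact ⟨π⁻¹ c, π⁻¹ a, π⁻¹ b, π⁻¹ d, h1, h2, h3, by simpa, by simpa, by simpa⟩
  · rintro ⟨a, b, c, d, hab, hbc, hcd, h1, h2, h3⟩
    exact ⟨π b, π c, π a, π d, h1, h2, h3, by simpa, by simpa, by simpa⟩

theorem splits_inv {n : ℕ} {π : Equiv.Perm (Fin n)} {j : ℕ} (h : Splits π j) : Splits π⁻¹ j := by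
  intro i hi
  by_contra hlt
  have := h.le_apply (not_lt.1 hlt)
  simp at this
  omega

theorem indecomposable_inv {n : ℕ} (π : Equiv.Perm (Fin n)) :
    Indecomposable π⁻¹ ↔ Indecomposable π := by
  simp only [indecomposable_iff]
  have : ∀ j, Splits π⁻¹ j ↔ Splits π j := fun j =>
    ⟨fun h => by simpa using splits_inv h, splits_inv⟩
  simp [this]

theorem avoidCount_3124 (n : ℕ) : avoidCount ![3, 1, 2, 4] n = avoidCount ![2, 3, 1, 4] n := by
  have h := ncard_preimage_equiv (Equiv.inv (Equiv.Perm (Fin n)))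
    fun π => Avoids ![2, 3, 1, 4] π
  simp only [Equiv.inv_apply, avoids_2314_inv] at h
  exact h

theorem indecCount_3124 (n : ℕ) : indecCount ![3, 1, 2, 4] n = indecCount ![2, 3, 1, 4] n := by
  have h := ncard_preimage_equiv (Equiv.inv (Equiv.Perm (Fin n)))
    fun π => Avoids ![2, 3, 1, 4] π ∧ Indecomposable π
  simp only [Equiv.inv_apply, avoids_2314_inv, indecomposable_inv] at h
  exact h

theorem avoids_1342_rev {n : ℕ} (π : Equiv.Perm (Fin n)) :
    Avoids ![1, 3, 4, 2] (Fin.revPerm.permCongr π) ↔ Avoids ![3, 1, 2, 4] π := by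
  simp only [Avoids, contains_1342_iff, contains_3124_iff, Equiv.permCongr_apply,
    Fin.revPerm_symm, Fin.revPerm_apply, Fin.rev_lt_rev]
  refine not_congr ⟨?_, ?_⟩
  · rintro ⟨a, b, c, d, hab, hbc, hcd, h1, h2, h3⟩
    exact ⟨d.rev, c.rev, b.rev, a.rev, by simpa, by simpa, by simpa, h3, h2, h1⟩
  · rintro ⟨a, b, c, d, hab, hbc, hcd, h1, h2, h3⟩
    exact ⟨d.rev, c.rev, b.rev, a.rev, by simpa, by simpa, by simpa, by simpa, by simpa, by simpa⟩

theorem avoidCount_1342 (n : ℕ) : avoidCount ![1, 3, 4, 2] n = avoidCount ![3, 1, 2, 4] n := by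
  have h := ncard_preimage_equiv (Fin.revPerm (n := n)).permCongr
    fun π => Avoids ![1, 3, 4, 2] π
  simp only [avoids_1342_rev] at h
  exact h.symm

/-! ### Indecomposable permutations avoiding 231 -/

/-- The permutation `n, β₀, β₁, …` of `Fin (n + 1)`: the maximum is put before `β`. The cyclic shift
moves the value `0`, which is in front, to the top. -/
def maxCons {n : ℕ} (β : Equiv.Perm (Fin n)) : Equiv.Perm (Fin (n + 1)) :=
  (Equiv.Perm.decomposeFin.symm (0, β)).trans (finRotate (n + 1)).symm

@[simp]
theorem maxCons_zero {n : ℕ} (β : Equiv.Perm (Fin n)) : maxCons β 0 = Fin.last n := by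
  rw [maxCons, Equiv.trans_apply, Equiv.symm_apply_eq, finRotate_last]
  simp

@[simp]
theorem maxCons_succ {n : ℕ} (β : Equiv.Perm (Fin n)) (i : Fin n) :
    maxCons β i.succ = (β i).castSucc := by
  rw [maxCons, Equiv.trans_apply, Equiv.symm_apply_eq, finRotate_apply,
    Equiv.Perm.decomposeFin_symm_apply_succ]
  simp

theorem maxCons_injective {n : ℕ} : Function.Injective (maxCons (n := n)) := by
  intro β γ h
  ext i
  simpa using congrArg (fun π => (π i.succ : ℕ)) h

theorem exists_maxCons {n : ℕ} {π : Equiv.Perm (Fin (n + 1))} (h : π 0 = Fin.last n) :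
    ∃ β, maxCons β = π := by
  set ρ := π.trans (finRotate (n + 1)) with hρ
  have h0 : ρ 0 = 0 := by rw [hρ, Equiv.trans_apply, h, finRotate_last]
  obtain ⟨⟨p, β⟩, hp⟩ := Equiv.Perm.decomposeFin.symm.surjective ρ
  have hp0 : p = 0 := by
    rw [← h0, ← hp, Equiv.Perm.decomposeFin_symm_apply_zero]
  subst hp0
  refine ⟨β, ?_⟩
  rw [maxCons, hp, hρ]
  ext; simp

theorem avoids_231_maxCons {n : ℕ} (β : Equiv.Perm (Fin n)) :
    Avoids ![2, 3, 1] (maxCons β) ↔ Avoids ![2, 3, 1] β := by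
  simp only [Avoids, contains_231_iff]
  refine not_congr ⟨?_, ?_⟩
  · rintro ⟨a, b, c, hab, hbc, h1, h2⟩
    have ha : a ≠ 0 := by
      rintro rfl
      rw [maxCons_zero] at h2
      exact absurd h2 (not_lt.2 (Fin.le_last _))
    obtain ⟨a, rfl⟩ := Fin.exists_succ_eq.2 ha
    obtain ⟨b, rfl⟩ := Fin.exists_succ_eq.2 (Fin.ne_zero_of_lt hab)
    obtain ⟨c, rfl⟩ := Fin.exists_succ_eq.2 (Fin.ne_zero_of_lt hbc)
    simp only [maxCons_succ, Fin.castSucc_lt_castSucc_iff, Fin.succ_lt_succ_iff] at *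
    exact ⟨a, b, c, hab, hbc, h1, h2⟩
  · rintro ⟨a, b, c, hab, hbc, h1, h2⟩
    exact ⟨a.succ, b.succ, c.succ, by simpa, by simpa, by simpa, by simpa⟩

/-- In a permutation avoiding 231 every entry before the maximum is smaller than every entry after
it, so the permutation splits before its maximum unless the maximum comes first. -/
theorem indecomposable_iff_of_avoids_231 {n : ℕ} {π : Equiv.Perm (Fin (n + 1))}
    (h : Avoids ![2, 3, 1] π) : Indecomposable π ↔ π 0 = Fin.last n := by
  rw [indecomposable_iff]
  constructor
  · rintro ⟨-, hind⟩
    obtain ⟨k, hk⟩ := π.surjective (Fin.last n)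
    by_contra h0
    have hk0 : k ≠ 0 := by rintro rfl; exact h0 hk
    refine hind k (Fin.lt_def.1 (Fin.pos_of_ne_zero hk0)) k.2 fun i hi => ?_
    have hlt : ∀ i' : Fin (n + 1), k ≤ i' → π i < π i' := by
      intro i' hi'
      have hlast : π i < π k := by
        rw [hk]
        refine lt_of_le_of_ne (Fin.le_last _) fun he => ?_
        rw [← hk] at he
        rw [π.injective he] at hi
        exact lt_irrefl _ hi
      rcases hi'.eq_or_lt with rfl | hi'
      · exact hlast
      · by_contra hcon
        have hne : π i' ≠ π i := fun he => by
          rw [π.injective he] at hi'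
          exact absurd (Fin.lt_def.1 hi') (by omega)
        exact h ((contains_231_iff π).2
          ⟨i, k, i', hi, hi', lt_of_le_of_ne (not_lt.1 hcon) hne, hlast⟩)
    -- The entries from position `k` on all exceed `π i`, which leaves too little room if `k ≤ π i`.
    have hcard := Finset.card_le_card_of_injOn (s := Finset.Ici k) (t := Finset.Ioi (π i)) π
      (fun i' hi' => by simpa using hlt i' (by simpa using hi')) π.injective.injOn
    rw [Fin.card_Ici, Fin.card_Ioi] at hcard
    omega
  · intro h0
    refine ⟨n.succ_pos, fun j hj hjn hs => ?_⟩
    have := hs 0 (by simpa using hj)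
    rw [h0, Fin.val_last] at this
    omega

theorem indecCount_231_succ (n : ℕ) : indecCount ![2, 3, 1] (n + 1) = avoidCount ![2, 3, 1] n := by
  have h : {π : Equiv.Perm (Fin (n + 1)) | Avoids ![2, 3, 1] π ∧ Indecomposable π}
      = maxCons '' {β | Avoids ![2, 3, 1] β} := by
    ext π
    constructor
    · rintro ⟨h1, h2⟩
      obtain ⟨β, rfl⟩ := exists_maxCons ((indecomposable_iff_of_avoids_231 h1).1 h2)
      exact ⟨β, (avoids_231_maxCons β).1 h1, rfl⟩
    · rintro ⟨β, hβ, rfl⟩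
      have h1 := (avoids_231_maxCons β).2 hβ
      exact ⟨h1, (indecomposable_iff_of_avoids_231 h1).2 (maxCons_zero β)⟩
  rw [indecCount, h, Set.ncard_image_of_injective _ maxCons_injective, avoidCount]

theorem indecCount_zero {k : ℕ} (σ : Fin k → ℕ) : indecCount σ 0 = 0 := by
  rw [indecCount, Set.ncard_eq_zero]
  ext π
  simp [Indecomposable]

/-! ### Specialisation to number series -/

/-- The substitution `q = 1`, with rational coefficients. -/
noncomputable def forgetDes : ℤ[X]⟦X⟧ →+* ℚ⟦X⟧ :=
  PowerSeries.map (Polynomial.eval₂RingHom (Int.castRingHom ℚ) 1)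

theorem eval_desSum {n : ℕ} (P : Equiv.Perm (Fin n) → Prop) :
    (desSum P).eval₂ (Int.castRingHom ℚ) 1 = Set.ncard {π | P π} := by
  classical
  have : {π | P π} = ((Finset.univ.filter fun π => P π : Finset _) : Set (Equiv.Perm (Fin n))) := by
    ext; simp
  rw [desSum, Polynomial.eval₂_finsetSum, this, Set.ncard_coe_finset]
  simp

theorem forgetDes_avoidGF₂ {k : ℕ} (σ : Fin k → ℕ) : forgetDes (avoidGF₂ σ) = avoidGF σ := by
  ext n
  rw [forgetDes, PowerSeries.coeff_map, coeff_avoidGF₂, avoidGF, PowerSeries.coeff_mk,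
    Polynomial.coe_eval₂RingHom, eval_desSum]
  rfl

theorem forgetDes_indecGF₂ {k : ℕ} (σ : Fin k → ℕ) : forgetDes (indecGF₂ σ) = indecGF σ := by
  ext n
  rw [forgetDes, PowerSeries.coeff_map, coeff_indecGF₂, indecGF, PowerSeries.coeff_mk,
    Polynomial.coe_eval₂RingHom, eval_desSum]
  rfl

theorem avoidGF₂_2314 : avoidGF₂ ![2, 3, 1, 4]
    = 1 + indecGF₂ ![2, 3, 1, 4] + indecGF₂ ![2, 3, 1] * (avoidGF₂ ![2, 3, 1, 4] - 1) :=
  avoidGF₂_eq (by norm_num) fun _ _ _ hm => avoids_2314_directSum hm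

theorem avoidGF₂_3124 : avoidGF₂ ![3, 1, 2, 4]
    = 1 + indecGF₂ ![3, 1, 2, 4] + indecGF₂ ![3, 1, 2] * (avoidGF₂ ![3, 1, 2, 4] - 1) :=
  avoidGF₂_eq (by norm_num) fun _ _ _ hm => avoids_3124_directSum hm

theorem indecGF_231 : indecGF ![2, 3, 1] = PowerSeries.X * avoidGF ![2, 3, 1] := by
  ext n
  cases n with
  | zero => simp [indecGF, indecCount_zero]
  | succ n => simp [indecGF, avoidGF, PowerSeries.coeff_succ_X_mul, indecCount_231_succ]

theorem avoidGF_231_eq : avoidGF ![2, 3, 1]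
    = 1 + PowerSeries.X * avoidGF ![2, 3, 1] ^ 2 := by
  have h := congrArg forgetDes (avoidGF₂_eq (σ := ![2, 3, 1]) (ρ := ![2, 3, 1]) (by norm_num)
    fun _ _ _ _ => avoids_231_directSum)
  rw [map_add, map_add, map_mul, map_sub, map_one, forgetDes_avoidGF₂, forgetDes_indecGF₂,
    indecGF_231] at h
  linear_combination h

theorem avoidGF_231 : avoidGF ![2, 3, 1] = PowerSeries.mk fun n => (catalan n : ℚ) := by
  set A := avoidGF ![2, 3, 1]
  have hA : A = 1 + PowerSeries.X * A ^ 2 := avoidGF_231_eq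
  let c : ℚ⟦X⟧ := PowerSeries.map (Nat.castRingHom ℚ) PowerSeries.catalanSeries
  have hc : c ^ 2 * PowerSeries.X + 1 = c := by
    have := congrArg (PowerSeries.map (Nat.castRingHom ℚ))
      PowerSeries.catalanSeries_sq_mul_X_add_one
    simpa using this
  have h : (A - c) * (1 - PowerSeries.X * (A + c)) = 0 := by linear_combination hA + hc
  have h2 : A - c = 0 := (mul_eq_zero.1 h).resolve_right fun h0 => by
    have := congrArg PowerSeries.constantCoeff h0
    simp at this
  rw [sub_eq_zero.1 h2]
  ext n
  simp [c]

/-- The quadratic equation of the Catalan series, solved. -/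
theorem one_sub_indecGF_231 : 1 - indecGF ![2, 3, 1]
    = PowerSeries.C (1 / 2) * (sqrtOneSubFourX + 1) := by
  rw [indecGF_231]
  set A := avoidGF ![2, 3, 1]
  have hA : A = 1 + PowerSeries.X * A ^ 2 := avoidGF_231_eq
  have hhalf : 2 * PowerSeries.C (1 / 2 : ℚ) = 1 := by
    rw [← map_ofNat PowerSeries.C 2, ← map_mul]; norm_num
  have h : (1 - 2 * PowerSeries.X * A - sqrtOneSubFourX)
      * (1 - 2 * PowerSeries.X * A + sqrtOneSubFourX) = 0 := by
    linear_combination -4 * PowerSeries.X * hA - sqrtOneSubFourX_sq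
  have h2 := (mul_eq_zero.1 h).resolve_right fun h0 => by
    have := congrArg PowerSeries.constantCoeff h0
    have h1 : PowerSeries.constantCoeff sqrtOneSubFourX = 1 := constantCoeff_binomPow _ _
    simp [h1] at this
  linear_combination PowerSeries.C (1 / 2) * h2 - (1 - PowerSeries.X * A) * hhalf

theorem indecGF_2314 : indecGF ![2, 3, 1, 4]
    = (1 - indecGF ![2, 3, 1]) * (avoidGF ![2, 3, 1, 4] - 1) := by
  have h := congrArg forgetDes avoidGF₂_2314
  rw [map_add, map_add, map_mul, map_sub, map_one, forgetDes_avoidGF₂, forgetDes_indecGF₂,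
    forgetDes_indecGF₂] at h
  linear_combination -h

theorem avoidCount_eq_bonaNumber {n : ℕ} (hn : 1 ≤ n) :
    (avoidCount ![2, 3, 1, 4] n : ℚ) = bonaNumber n := by
  rw [← coeff_walkGF_eq_bonaNumber hn, ← avoidGF_2314, avoidGF, PowerSeries.coeff_mk]

theorem indecCount_2314 (n : ℕ) : (indecCount ![2, 3, 1, 4] (n + 1) : ℚ)
    = bonaNumber (n + 1) - ∑ i ∈ Finset.range n, (catalan i : ℚ) * bonaNumber (n - i) := by
  have h := congrArg (PowerSeries.coeff (n + 1)) indecGF_2314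
  rw [indecGF, PowerSeries.coeff_mk, indecGF_231, avoidGF_231, sub_mul, one_mul, map_sub, map_sub,
    mul_assoc, PowerSeries.coeff_succ_X_mul, PowerSeries.coeff_mul,
    Finset.Nat.sum_antidiagonal_eq_sum_range_succ_mk, Finset.sum_range_succ,
    PowerSeries.coeff_one, if_neg n.succ_ne_zero, avoidGF, PowerSeries.coeff_mk,
    avoidCount_eq_bonaNumber (by omega)] at h
  rw [h]
  have h0 : avoidCount ![2, 3, 1, 4] 0 = 1 := by
    have := avoidCount_2314 0
    rw [walkSum_zero] at this
    exact_mod_cast this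
  simp only [PowerSeries.coeff_mk, map_sub, PowerSeries.coeff_one, h0, sub_zero, Nat.sub_self,
    if_true, Nat.cast_one, sub_self, mul_zero, add_zero]
  congr 1
  refine Finset.sum_congr rfl fun i hi => ?_
  rw [Finset.mem_range] at hi
  rw [if_neg (by omega), avoidCount_eq_bonaNumber (by omega), sub_zero]

end IndecPerm


theorem mainTheorem4 :
    -- the relations between the descent generating functions
    avoidGF₂ ![2, 3, 1, 4]
        = 1 + indecGF₂ ![2, 3, 1, 4] + indecGF₂ ![2, 3, 1] * (avoidGF₂ ![2, 3, 1, 4] - 1) ∧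
    avoidGF₂ ![3, 1, 2, 4]
        = 1 + indecGF₂ ![3, 1, 2, 4] + indecGF₂ ![3, 1, 2] * (avoidGF₂ ![3, 1, 2, 4] - 1) ∧
    -- `F(x)` and `F_n` enumerate the permutations avoiding 1342, 2314 or 3124
    (∀ τ ∈ ({![1, 3, 4, 2], ![2, 3, 1, 4], ![3, 1, 2, 4]} : Set (Fin 4 → ℕ)),
      (avoidGF τ : ℚ⸨X⸩) = bonaF ∧
      ∀ n : ℕ, 1 ≤ n → (avoidCount τ n : ℚ) = bonaNumber n) ∧
    -- the enumeration of the indecomposable permutations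
    (∀ σ ∈ ({![2, 3, 1, 4], ![3, 1, 2, 4]} : Set (Fin 4 → ℕ)),
      (indecGF σ : ℚ⸨X⸩) = (1 / 2) * ((sqrtOneSubFourX : ℚ⸨X⸩) + 1) * (bonaF - 1) ∧
      indecCount σ 1 = 1 ∧
      ∀ n : ℕ, 2 ≤ n →
        (indecCount σ n : ℚ)
          = bonaNumber n
            - ∑ i ∈ Finset.range (n - 1), (catalan i : ℚ) * bonaNumber (n - 1 - i)) := by
  refine ⟨avoidGF₂_2314, avoidGF₂_3124, fun τ hτ => ?_, fun σ hσ => ?_⟩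
  · have h : ∀ n, avoidCount τ n = avoidCount ![2, 3, 1, 4] n := by
      rcases hτ with rfl | rfl | rfl
      · exact fun n => (avoidCount_1342 n).trans (avoidCount_3124 n)
      · exact fun n => rfl
      · exact avoidCount_3124
    have h2 : avoidGF τ = avoidGF ![2, 3, 1, 4] := by simp only [avoidGF, h]
    refine ⟨?_, fun n hn => by rw [h, avoidCount_eq_bonaNumber hn]⟩
    rw [h2, avoidGF_2314, coe_walkGF_eq_bonaF]
  · have h : ∀ n, indecCount σ n = indecCount ![2, 3, 1, 4] n := by
      rcases hσ with rfl | rfl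
      · exact fun n => rfl
      · exact indecCount_3124
    have h2 : indecGF σ = indecGF ![2, 3, 1, 4] := by simp only [indecGF, h]
    refine ⟨?_, ?_, fun n hn => ?_⟩
    · rw [h2, indecGF_2314, one_sub_indecGF_231, avoidGF_2314, ← coe_walkGF_eq_bonaF]
      have hC : ((PowerSeries.C (1 / 2 : ℚ) : ℚ⟦X⟧) : ℚ⸨X⸩) = 1 / 2 := by
        have h2 : (2 : ℚ⟦X⟧) * PowerSeries.C (1 / 2 : ℚ) = 1 := by
          rw [← map_ofNat PowerSeries.C 2, ← map_mul]; norm_num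
        have h3 := congrArg (HahnSeries.ofPowerSeries ℤ ℚ) h2
        rw [map_mul, map_one, map_ofNat] at h3
        rw [eq_div_iff (fun h0 => by rw [h0, zero_mul] at h3; exact zero_ne_one h3), mul_comm]
        exact h3
      rw [← hC]
      push_cast
      rfl
    · have h1 := indecCount_2314 0
      rw [← h] at h1
      have : bonaNumber 1 = 1 := by norm_num [bonaNumber]
      rw [this] at h1
      simpa using h1
    · obtain ⟨m, rfl⟩ : ∃ m, n = m + 1 := ⟨n - 1, by omega⟩
      rw [h, indecCount_2314]
      simp
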